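/- Let $M$ be a connected open subset of the Euclidean plane with Euclidean coordinates $(x,y)$ and fibre coordinates $(u,v)$ on the tangent bundle. Let $\phi,a,b$ be smooth real functions on $M$ such that $$F(x,y,u,v)=e^{\phi(x,y)}\sqrt{u^2+v^2}+a(x,y)\,u+b(x,y)\,v$$ is positive for $(u,v)\neq(0,0)$, i.e. $F$ is a Finsler metric of Randers type whose Riemannian part $e^{2\phi}(dx^2+dy^2)$ is conformal to the Euclidean metric. Put $f=e^{-\phi}$. A geodesic of $F$ is a regular curve in $M$ that satisfies the Euler–Lagrange equations of $F$; it is called a circle if it runs along a Euclidean circle or a straight line. 1. If all geodesics of $F$ are circles, then the Riemannian part of $F$ has constant Gaussian curvature. 2. All geodesics of $F$ are circles if and only if there are real constants $l,m,n,p,k$ such that on $M$ $$f=l(x^2+y^2)+mx+ny+p\qquad\text{and}\qquad f^2\left(\frac{\partial a}{\partial y}-\frac{\partial b}{\partial x}\right)=k.$$ Whenever $f$ has this quadratic form, the Gaussian curvature of the Riemannian part is the constant $4lp-(m^2+n^2)$. 3. Consider the three one-parameter families $$F_\tau=\sqrt{u^2+v^2}+\tau(yu-xv),\qquad F_\tau=\frac{2\left(\sqrt{u^2+v^2}+\tau(yu-xv)\right)}{1+(x^2+y^2)},\qquad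 F_\tau=\frac{2\left(\sqrt{u^2+v^2}+\tau(yu-xv)\right)}{1-(x^2+y^2)},$$ $\tau\in\mathbb R$, the first two on the plane and the third on the open unit disk $x^2+y^2<1$. The Gaussian curvature of their Riemannian parts ($\tau=0$) is respectively $0$, $+1$ and $-1$. All geodesics of $F$ are circles if and only if, up to a Möbius transformation, a positive constant factor and an added total derivative, $F$ is a member of one of these families; that is, if and only if for one of the families there are a fractional-linear map $T$ (of the complex coordinate $x+iy$, without pole in $M$, mapping $M$ into the domain of the family), a constant $c>0$ and a $\tau\in\mathbb R$ such that on every simply connected open $U\subseteq M$ (in particular on $M$, if $M$ is simply connected) $$F=c\,T^*F_\tau+\frac{\partial\psi}{\partial x}u+\frac{\partial\psi}{\partial y}v$$ for some smooth function $\psi$ on $U$, where $T^*F_\tau$ is the pull-back of $F_\tau$ by $T$ and its differential. -/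

import Mathlib

open scoped ContDiff

noncomputable section

namespace CircleGeodesics

/-! The Euclidean plane is `ℂ`, with `z = x + i y` a point and `w = u + i v` a tangent vector, so
that `‖w‖ = √(u² + v²)`. A Finsler function is a function `F z w` of a point and a tangent vector. -/

/-- The coordinate directions `∂/∂x` and `∂/∂y` of the plane. -/
def coordVec : Fin 2 → ℂ := ![1, Complex.I]

/-- The partial derivative of a real function in the `i`-th coordinate (`0` for `x`, `1` for `y`). -/
def pd (i : Fin 2) (g : ℂ → ℝ) (z : ℂ) : ℝ := fderiv ℝ g z (coordVec i)

/-! ### Curvature of a Riemannian metric in the coordinates `(x, y)` -/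

/-- The Christoffel symbol `Γ^k_{ij}` of the metric `g`. -/
def christoffel (g : ℂ → Matrix (Fin 2) (Fin 2) ℝ) (k i j : Fin 2) (z : ℂ) : ℝ :=
  (1 / 2) * ∑ l, (g z)⁻¹ k l *
    (pd i (fun p => g p j l) z + pd j (fun p => g p i l) z - pd l (fun p => g p i j) z)

/-- The component `R^l_{kij}` of the curvature tensor: `R(∂_i, ∂_j) ∂_k = ∑ l, R^l_{kij} ∂_l`. -/
def riemannTensor (g : ℂ → Matrix (Fin 2) (Fin 2) ℝ) (l k i j : Fin 2) (z : ℂ) : ℝ :=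
  pd i (christoffel g l j k) z - pd j (christoffel g l i k) z
    + ∑ m, (christoffel g l i m z * christoffel g m j k z
      - christoffel g l j m z * christoffel g m i k z)

/-- The Gaussian curvature `g(R(∂_x, ∂_y) ∂_y, ∂_x) / det g`. -/
def gaussianCurvature (g : ℂ → Matrix (Fin 2) (Fin 2) ℝ) (z : ℂ) : ℝ :=
  (∑ l, g z 0 l * riemannTensor g l 1 0 1 z) / (g z).det

/-- The metric `ρ² (dx² + dy²)`, in which a tangent vector `w` at `z` has length `ρ z * ‖w‖`. -/
def conformalMetric (ρ : ℂ → ℝ) (z : ℂ) : Matrix (Fin 2) (Fin 2) ℝ :=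
  (ρ z ^ 2) • (1 : Matrix (Fin 2) (Fin 2) ℝ)

/-! ### Randers functions and their geodesics -/

/-- `F = e^φ √(u² + v²) + a u + b v`. -/
def randers (φ a b : ℂ → ℝ) (z w : ℂ) : ℝ :=
  Real.exp (φ z) * ‖w‖ + a z * w.re + b z * w.im

/-- `γ`, restricted to the open interval `J`, is a (regular, twice continuously differentiable,
arbitrarily parametrized) geodesic of `F` in `M`: it solves the Euler-Lagrange equations
`d/dt (∂F/∂w) = ∂F/∂z` along `(γ, γ')`. -/
structure IsGeodesic (F : ℂ → ℂ → ℝ) (M : Set ℂ) (J : Set ℝ) (γ : ℝ → ℂ) : Prop where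
  isOpen : IsOpen J
  ordConnected : J.OrdConnected
  contDiffOn : ContDiffOn ℝ 2 γ J
  mem : ∀ t ∈ J, γ t ∈ M
  regular : ∀ t ∈ J, deriv γ t ≠ 0
  eulerLagrange : ∀ t ∈ J, ∀ e : ℂ,
    HasDerivAt (fun s => fderiv ℝ (fun w => F (γ s) w) (deriv γ s) e)
      (fderiv ℝ (fun z => F z (deriv γ t)) (γ t) e) t

/-- `C` is a Euclidean circle of positive radius or a straight line. -/
def IsCircleOrLine (C : Set ℂ) : Prop :=
  (∃ c : ℂ, ∃ r : ℝ, 0 < r ∧ C = Metric.sphere c r) ∨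
    (∃ p d : ℂ, d ≠ 0 ∧ C = Set.range fun s : ℝ => p + s * d)

/-- Every geodesic of `F` in `M` runs along a circle or a line. -/
def AllGeodesicsCircles (F : ℂ → ℂ → ℝ) (M : Set ℂ) : Prop :=
  ∀ (J : Set ℝ) (γ : ℝ → ℂ), IsGeodesic F M J γ → ∃ C, IsCircleOrLine C ∧ γ '' J ⊆ C

/-! ### The model families, indexed by the sign `ε` of the curvature -/

/-- The domain of the model: the plane for `ε = 0, 1`, the open unit disk for `ε = -1`. -/
def modelDomain : SignType → Set ℂ
  | .zero => Set.univ
  | .pos => Set.univ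
  | .neg => Metric.ball 0 1

/-- The conformal factor of the model: `1`, `2 / (1 + (x² + y²))`, `2 / (1 - (x² + y²))`. -/
def modelFactor : SignType → ℂ → ℝ
  | .zero, _ => 1
  | .pos, z => 2 / (1 + ‖z‖ ^ 2)
  | .neg, z => 2 / (1 - ‖z‖ ^ 2)

/-- `F_τ`, the conformal factor times `√(u² + v²) + τ (y u - x v)`. -/
def modelRanders (ε : SignType) (τ : ℝ) (z w : ℂ) : ℝ :=
  modelFactor ε z * (‖w‖ + τ * (z.im * w.re - z.re * w.im))

/-- The fractional-linear map `z ↦ (α z + β) / (γ z + δ)`. -/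
def moebius (α β γ δ z : ℂ) : ℂ := (α * z + β) / (γ * z + δ)

/-- On `M`, up to a Möbius transformation (finite on `M`, and mapping `M` into the domain of the
model), a positive constant factor and an added total derivative, `F` is a member `F_τ` of the model
family of index `ε`. The total derivative `dψ` is that of a smooth function on any prescribed simply
connected open part `U` of `M`, thus on `M` itself when `M` is simply connected. -/
def EquivModel (F : ℂ → ℂ → ℝ) (M : Set ℂ) (ε : SignType) (τ : ℝ) : Prop :=
  ∃ (α β γ δ : ℂ) (c : ℝ), α * δ - β * γ ≠ 0 ∧ 0 < c ∧
    (∀ z ∈ M, γ * z + δ ≠ 0 ∧ moebius α β γ δ z ∈ modelDomain ε) ∧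
    ∀ U ⊆ M, IsOpen U → IsSimplyConnected U →
      ∃ ψ : ℂ → ℝ, ContDiffOn ℝ ∞ ψ U ∧ ∀ z ∈ U, ∀ w : ℂ,
        F z w = c * modelRanders ε τ (moebius α β γ δ z) (deriv (moebius α β γ δ) z * w)
          + fderiv ℝ ψ z w

end CircleGeodesics

end

noncomputable section

namespace CircleGeodesics

open Set Filter Topology

/-! Write `f = e^{-φ}` and `q = f² (a_y - b_x)`. The Euler–Lagrange equations of a Randers function
are invariant under reparametrization and say only how the Euclidean unit tangent `T` turns: the
Euclidean curvature of a geodesic is `κ = (q - ⟨∇f, iT⟩) / f` (`IsGeodesic.hasDerivAt_tangent`;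
`isGeodesic_of_hasDerivAt` is the converse). Differentiating along a unit-speed geodesic, the terms
in `κ` cancel, leaving `κ' = (∂_T q - Hess f (T, iT)) / f` (`hasDerivAt_geodesicCurvature`).

A curve runs along a circle or line iff `κ' = 0`, and a geodesic leaves every point in every
direction (`exists_isGeodesic`). So all geodesics are circles iff `∂_T q = Hess f (T, iT)` for all
unit `T`. The left side is odd in `T` and the right side even, so both vanish: `q` is constant and
`Hess f` is a multiple of the identity. On a connected set this makes `f` quadratic. The curvature
is `f Δf - |∇f|²`, which for such `f` is the constant `D = 4lp - (m² + n²)`.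

For the models, the sign of `D` selects the family, and the identity `|∇f|² = 4lf - D` exhibits the
Möbius map whenever `l ≠ 0` (`exists_moebius_of_quadratic`). This matches the Riemannian parts.
Constancy of `q` then makes the exterior derivatives of the linear parts agree for one `τ`, so these
parts differ by a closed form, exact on simply connected sets by
`exists_hasFDerivAt_of_isSimplyConnected`. -/

/-- Local functions on a simply connected space which differ by constants on the overlaps of their
domains are, up to constants, the restrictions of one global function. -/
theorem exists_glue_of_sub_const {X : Type*} [TopologicalSpace X] [SimplyConnectedSpace X]
    [LocallyPathConnectedSpace X] (B : X → Set X) (hB : ∀ x, IsOpen (B x)) (hmem : ∀ x, x ∈ B x)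
    (g : X → X → ℝ) (hg : ∀ x y, ∃ c, ∀ z ∈ B x ∩ B y, g x z - g y z = c) :
    ∃ ψ : X → ℝ, ∀ x, ∀ z ∈ B x, ∀ᶠ y in 𝓝 z, ψ y - g x y = ψ z - g x z := by
  -- With discrete fibres the bundle of germs `g x + const` is a covering, and a continuous section
  -- is a locally constant choice of constants.
  let _ : TopologicalSpace ℝ := ⊥
  have : DiscreteTopology ℝ := ⟨rfl⟩
  let Z : FiberBundleCore X X ℝ :=
    { baseSet := B
      isOpen_baseSet := hB
      indexAt := id
      mem_baseSet_at := hmem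
      coordChange := fun i j x v => v + g i x - g j x
      coordChange_self := fun i x _ v => by ring
      continuousOn_coordChange := fun i j => by
        obtain ⟨c, hc⟩ := hg i j
        have h : Continuous fun p : X × ℝ => p.2 + c :=
          (continuous_of_discreteTopology (f := fun v : ℝ => v + c)).comp continuous_snd
        refine h.continuousOn.congr fun p hp => ?_
        have := hc p.1 hp.1
        simp only
        linarith
      coordChange_comp := fun i j k x _ v => by ring }
  have hcov : IsCoveringMap Z.proj := FiberBundle.isCoveringMap (F := ℝ) (E := Z.Fiber)
  obtain ⟨x₀⟩ : Nonempty X := inferInstance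
  -- Simple connectedness lifts the identity map to the covering; the lift is a global section.
  obtain ⟨s, ⟨-, hs⟩, -⟩ := hcov.existsUnique_continuousMap_lifts (ContinuousMap.id X) x₀
    (⟨x₀, (0 : ℝ)⟩ : Z.TotalSpace) rfl
  have hs' : ∀ y, (s y).1 = y := fun y => congrFun hs y
  let σ : X → ℝ := fun y => (s y).2
  let v : X → X → ℝ := fun x y => (Z.localTriv x (s y)).2
  have hv : ∀ x y, v x y = σ y + g y y - g x y := fun x y => by
    simp only [v, FiberBundleCore.localTriv_apply]
    change σ y + g (s y).1 (s y).1 - g x (s y).1 = _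
    rw [hs' y]
  refine ⟨fun y => σ y + g y y, fun x z hz => ?_⟩
  -- In the trivialization at `x` the section reads `ψ - g x`; being continuous into a discrete
  -- space, it is locally constant.
  have hc : ContinuousAt (v x) z := by
    refine continuous_snd.continuousAt.comp ?_
    refine ContinuousAt.comp ?_ s.continuous.continuousAt
    refine (Z.localTriv x).continuousAt ?_
    rw [FiberBundleCore.mem_localTriv_source, ← FiberBundleCore.baseSet_at]
    change (s z).1 ∈ B x
    rwa [hs' z]
  have : ∀ᶠ y in 𝓝 z, v x y = v x z := by
    have := hc.tendsto
    rw [nhds_discrete ℝ, tendsto_pure] at this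
    exact this
  filter_upwards [this] with y hy
  rw [hv, hv] at hy
  exact hy

/-- Poincaré lemma: a closed `1`-form on a simply connected open set is exact. -/
theorem exists_hasFDerivAt_of_isSimplyConnected {E : Type*} [NormedAddCommGroup E]
    [NormedSpace ℝ E] {U : Set E} (hUo : IsOpen U) (hU : IsSimplyConnected U)
    {η : E → E →L[ℝ] ℝ} (hη : DifferentiableOn ℝ η U)
    (hd : ∀ z ∈ U, ∀ x y, fderiv ℝ η z x y = fderiv ℝ η z y x) :
    ∃ ψ : E → ℝ, ∀ z ∈ U, HasFDerivAt ψ (η z) z := by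
  classical
  have := hU.simplyConnectedSpace
  have := hUo.locallyPathConnectedSpace
  have hball : ∀ x : U, ∃ r > 0, Metric.ball (x : E) r ⊆ U := fun x =>
    Metric.isOpen_iff.1 hUo x x.2
  choose r hr hrU using hball
  have hprim : ∀ x : U, ∃ f : E → ℝ, ∀ z ∈ Metric.ball (x : E) (r x), HasFDerivAt f (η z) z :=
    fun x => (convex_ball _ _).exists_forall_hasFDerivAt_of_fderiv_symmetric Metric.isOpen_ball
      (hη.mono (hrU x)) fun z hz => hd z (hrU x hz)
  choose f hf using hprim
  obtain ⟨ψ, hψ⟩ := exists_glue_of_sub_const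
    (fun x : U => Subtype.val ⁻¹' Metric.ball (x : E) (r x))
    (fun x => Metric.isOpen_ball.preimage continuous_subtype_val)
    (fun x => Metric.mem_ball_self (hr x)) (fun x y => f x y) (fun x y => by
      -- Two primitives differ by one constant on the overlap because an intersection of balls is
      -- convex, hence connected.
      obtain ⟨c, hc⟩ := (Metric.isOpen_ball.inter Metric.isOpen_ball).exists_is_const_of_fderiv_eq_zero
        (𝕜 := ℝ) (f := fun z => f x z - f y z)
        ((convex_ball (x : E) (r x)).inter (convex_ball (y : E) (r y))).isPreconnected
        (fun z hz => ((hf x z hz.1).sub (hf y z hz.2)).differentiableAt.differentiableWithinAt)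
        (fun z hz => by simpa using ((hf x z hz.1).fun_sub (hf y z hz.2)).fderiv)
      exact ⟨c, fun z hz => hc z hz⟩)
  refine ⟨fun z => if h : z ∈ U then ψ ⟨z, h⟩ else 0, fun z hz => ?_⟩
  have hev := hψ ⟨z, hz⟩ ⟨z, hz⟩ (Metric.mem_ball_self (hr _))
  have hev' : ∀ᶠ y in 𝓝 z, (if h : y ∈ U then ψ ⟨y, h⟩ else 0)
      = f ⟨z, hz⟩ y + (ψ ⟨z, hz⟩ - f ⟨z, hz⟩ z) := by
    have h1 : ∀ᶠ y in 𝓝 z, ∀ h : y ∈ U, ψ ⟨y, h⟩ - f ⟨z, hz⟩ y = ψ ⟨z, hz⟩ - f ⟨z, hz⟩ z := by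
      rw [nhds_subtype_eq_comap] at hev
      have := eventually_comap.1 hev
      exact this.mono fun y hy h => hy ⟨y, h⟩ rfl
    filter_upwards [h1, hUo.mem_nhds hz] with y hy hyU
    rw [dif_pos hyU]
    linarith [hy hyU]
  exact ((hf ⟨z, hz⟩ z (Metric.mem_ball_self (hr _))).add_const _).congr_of_eventuallyEq hev'

/-! ### Partial derivatives -/

theorem _root_.HasFDerivAt.pd_eq {g : ℂ → ℝ} {g' : ℂ →L[ℝ] ℝ} {z : ℂ} (h : HasFDerivAt g g' z)
    (i : Fin 2) : pd i g z = g' (coordVec i) := by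
  rw [pd, h.fderiv]

theorem pd_congr {g h : ℂ → ℝ} {z : ℂ} (e : g =ᶠ[𝓝 z] h) (i : Fin 2) : pd i g z = pd i h z := by
  rw [pd, pd, e.fderiv_eq]

theorem clm_apply_eq (L : ℂ →L[ℝ] ℝ) (w : ℂ) : L w = w.re * L 1 + w.im * L Complex.I := by
  conv_lhs => rw [show w = w.re • (1 : ℂ) + w.im • Complex.I by
    simp [Complex.re_add_im]]
  rw [map_add, map_smul, map_smul, smul_eq_mul, smul_eq_mul]

theorem fderiv_apply_eq_pd (g : ℂ → ℝ) (z w : ℂ) :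
    fderiv ℝ g z w = w.re * pd 0 g z + w.im * pd 1 g z :=
  clm_apply_eq _ _

theorem fderiv_eq_zero_of_pd {g : ℂ → ℝ} {z : ℂ} (h0 : pd 0 g z = 0) (h1 : pd 1 g z = 0) :
    fderiv ℝ g z = 0 := by
  ext w
  rw [fderiv_apply_eq_pd, h0, h1]
  simp

/-! ### Curvature of `(dx² + dy²) / f²` for quadratic `f` -/

/-- The function `l (x² + y²) + m x + n y + p`. -/
def quadratic (l m n p : ℝ) (z : ℂ) : ℝ := l * (z.re ^ 2 + z.im ^ 2) + m * z.re + n * z.im + p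

/-- The partial derivatives of `quadratic l m n p`. -/
def quadraticPd (l m n : ℝ) (i : Fin 2) (z : ℂ) : ℝ := ![2 * l * z.re + m, 2 * l * z.im + n] i

theorem hasFDerivAt_re (z : ℂ) : HasFDerivAt Complex.re Complex.reCLM z :=
  Complex.reCLM.hasFDerivAt

theorem hasFDerivAt_im (z : ℂ) : HasFDerivAt Complex.im Complex.imCLM z :=
  Complex.imCLM.hasFDerivAt

theorem hasFDerivAt_quadratic (l m n p : ℝ) (z : ℂ) :
    HasFDerivAt (quadratic l m n p)
      (quadraticPd l m n 0 z • Complex.reCLM + quadraticPd l m n 1 z • Complex.imCLM) z := by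
  have h := (((((hasFDerivAt_re z).pow 2).add ((hasFDerivAt_im z).pow 2)).const_mul l).add
    ((hasFDerivAt_re z).const_mul m)).add ((hasFDerivAt_im z).const_mul n) |>.add_const p
  refine h.congr_fderiv ?_
  ext w
  simp [quadraticPd]
  ring

theorem pd_quadratic (l m n p : ℝ) (i : Fin 2) (z : ℂ) :
    pd i (quadratic l m n p) z = quadraticPd l m n i z := by
  rw [(hasFDerivAt_quadratic l m n p z).pd_eq]
  fin_cases i <;> simp [coordVec]

theorem hasFDerivAt_quadraticPd (l m n : ℝ) (i : Fin 2) (z : ℂ) :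
    HasFDerivAt (quadraticPd l m n i)
      ((2 * l) • ![Complex.reCLM, Complex.imCLM] i) z := by
  fin_cases i
  · exact ((hasFDerivAt_re z).const_mul (2 * l)).add_const m
  · exact ((hasFDerivAt_im z).const_mul (2 * l)).add_const n

theorem continuous_quadratic (l m n p : ℝ) : Continuous (quadratic l m n p) :=
  continuous_iff_continuousAt.2 fun z => (hasFDerivAt_quadratic l m n p z).continuousAt

theorem hasFDerivAt_inv_quadratic {l m n p : ℝ} {z : ℂ} (hz : quadratic l m n p z ≠ 0) :
    HasFDerivAt (fun y => (quadratic l m n p y)⁻¹) ((-(quadratic l m n p z ^ 2)⁻¹) •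
      (quadraticPd l m n 0 z • Complex.reCLM + quadraticPd l m n 1 z • Complex.imCLM)) z :=
  (hasDerivAt_inv hz).comp_hasFDerivAt z (hasFDerivAt_quadratic l m n p z)

/-- The logarithmic derivative of `1 / f` for `f = quadratic l m n p`. -/
def logPd (l m n p : ℝ) (i : Fin 2) (z : ℂ) : ℝ :=
  -(quadraticPd l m n i z / quadratic l m n p z)

/-- For `e^{2σ}` times the Euclidean metric, the Christoffel symbols are linear in `∇σ`; here `σ =
-log f` and `logPd` is its gradient. -/
theorem christoffel_conformalMetric {ρ : ℂ → ℝ} {l m n p : ℝ} {z : ℂ}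
    (hρ : ∀ᶠ y in 𝓝 z, ρ y = (quadratic l m n p y)⁻¹) (hz : quadratic l m n p z ≠ 0)
    (k i j : Fin 2) :
    christoffel (conformalMetric ρ) k i j z =
      (if j = k then logPd l m n p i z else 0) + (if i = k then logPd l m n p j z else 0)
        - (if i = j then logPd l m n p k z else 0) := by
  have hpd : ∀ r s t : Fin 2, pd r (fun y => conformalMetric ρ y s t) z =
      if s = t then 2 * (quadratic l m n p z)⁻¹ ^ 2 * logPd l m n p r z else 0 := by
    intro r s t
    have e : (fun y => conformalMetric ρ y s t) =ᶠ[𝓝 z]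
        fun y => (quadratic l m n p y)⁻¹ ^ 2 * if s = t then 1 else 0 := by
      filter_upwards [hρ] with y hy
      simp [conformalMetric, Matrix.one_apply, hy]
    rw [pd_congr e, (((hasFDerivAt_inv_quadratic hz).pow 2).mul_const _).pd_eq]
    split_ifs
    · fin_cases r <;> simp [coordVec, logPd] <;> field_simp
    · simp
  have hinv : (conformalMetric ρ z)⁻¹ = (quadratic l m n p z ^ 2) • (1 : Matrix _ _ ℝ) := by
    refine Matrix.inv_eq_right_inv ?_
    rw [conformalMetric, hρ.self_of_nhds, smul_mul_smul_comm, one_mul, inv_pow,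
      inv_mul_cancel₀ (pow_ne_zero 2 hz), one_smul]
  rw [christoffel, hinv]
  simp only [hpd, Matrix.smul_apply, Matrix.one_apply, Fin.sum_univ_two, smul_eq_mul]
  fin_cases k <;> fin_cases i <;> fin_cases j <;> simp <;> field_simp

/-- The curvature of `(dx² + dy²) / f²` is `f Δf - |∇f|²`; for a quadratic this is `4lf - |∇f|²`, in
which the dependence on the point cancels. -/
theorem gaussianCurvature_conformalMetric {ρ : ℂ → ℝ} {l m n p : ℝ} {z : ℂ}
    (hρ : ∀ᶠ y in 𝓝 z, ρ y = (quadratic l m n p y)⁻¹) (hz : quadratic l m n p z ≠ 0) :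
    gaussianCurvature (conformalMetric ρ) z = 4 * l * p - (m ^ 2 + n ^ 2) := by
  have hchr : ∀ k i j : Fin 2, christoffel (conformalMetric ρ) k i j =ᶠ[𝓝 z] fun y =>
      (if j = k then logPd l m n p i y else 0) + (if i = k then logPd l m n p j y else 0)
        - (if i = j then logPd l m n p k y else 0) := by
    intro k i j
    filter_upwards [hρ.eventually_nhds, (continuous_quadratic l m n p).continuousAt.eventually_ne hz]
      with y hy hy0
    exact christoffel_conformalMetric hy hy0 k i j
  have hlog : ∀ r i : Fin 2, pd r (logPd l m n p i) z =
      -(((if r = i then 2 * l else 0) * quadratic l m n p z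
        - quadraticPd l m n i z * quadraticPd l m n r z) / quadratic l m n p z ^ 2) := by
    intro r i
    have h := ((hasFDerivAt_quadraticPd l m n i z).mul
      (hasFDerivAt_inv_quadratic hz)).neg
    have e : logPd l m n p i = -(quadraticPd l m n i * fun y => (quadratic l m n p y)⁻¹) := by
      ext y
      simp [logPd, div_eq_mul_inv]
    rw [e, HasFDerivAt.pd_eq h]
    fin_cases r <;> fin_cases i <;> simp [coordVec] <;> field_simp <;> ring
  have h011 : christoffel (conformalMetric ρ) 0 1 1 =ᶠ[𝓝 z] fun y => -logPd l m n p 0 y := by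
    filter_upwards [hchr 0 1 1] with y hy
    simpa using hy
  have h001 : christoffel (conformalMetric ρ) 0 0 1 =ᶠ[𝓝 z] fun y => logPd l m n p 1 y := by
    filter_upwards [hchr 0 0 1] with y hy
    simpa using hy
  have hneg : pd 0 (fun y => -logPd l m n p 0 y) z = -pd 0 (logPd l m n p 0) z := by
    simp [pd]
  have hR : riemannTensor (conformalMetric ρ) 0 1 0 1 z =
      (4 * l * quadratic l m n p z
        - (quadraticPd l m n 0 z ^ 2 + quadraticPd l m n 1 z ^ 2)) / quadratic l m n p z ^ 2 := by
    rw [riemannTensor, pd_congr h011, pd_congr h001, hneg, hlog,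
      show (fun y => logPd l m n p 1 y) = logPd l m n p 1 from rfl, hlog]
    simp only [Fin.sum_univ_two, (hchr _ _ _).self_of_nhds, logPd]
    simp
    field_simp
    ring
  have hdet : (conformalMetric ρ z).det = (quadratic l m n p z)⁻¹ ^ 4 := by
    rw [conformalMetric, hρ.self_of_nhds, Matrix.det_smul]
    simp
    ring
  rw [gaussianCurvature, hdet, Fin.sum_univ_two, hR]
  simp only [conformalMetric, hρ.self_of_nhds, Matrix.smul_apply, Matrix.one_apply, smul_eq_mul]
  simp
  field_simp
  simp only [quadratic, quadraticPd]
  simp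
  ring

/-! ### Smooth functions on open sets of the plane -/

theorem contDiffOn_pd {M : Set ℂ} (hM : IsOpen M) {g : ℂ → ℝ} (hg : ContDiffOn ℝ ∞ g M)
    (i : Fin 2) : ContDiffOn ℝ ∞ (pd i g) M :=
  ((contDiffOn_infty_iff_fderiv_of_isOpen hM).1 hg).2.clm_apply contDiffOn_const

theorem differentiableAt_of_contDiffOn {M : Set ℂ} (hM : IsOpen M) {g : ℂ → ℝ}
    (hg : ContDiffOn ℝ ∞ g M) {z : ℂ} (hz : z ∈ M) : DifferentiableAt ℝ g z :=
  (hg.contDiffAt (hM.mem_nhds hz)).differentiableAt (by simp)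

theorem two_le_infty : (2 : WithTop ℕ∞) ≤ ∞ :=
  WithTop.coe_le_coe.2 (le_top : (2 : ℕ∞) ≤ ⊤)

theorem pd_pd_comm {M : Set ℂ} (hM : IsOpen M) {g : ℂ → ℝ} (hg : ContDiffOn ℝ ∞ g M) {z : ℂ}
    (hz : z ∈ M) (i j : Fin 2) : pd i (pd j g) z = pd j (pd i g) z := by
  have hd : DifferentiableAt ℝ (fderiv ℝ g) z :=
    (((contDiffOn_infty_iff_fderiv_of_isOpen hM).1 hg).2.contDiffAt
      (hM.mem_nhds hz)).differentiableAt (by simp)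
  have key : ∀ i j : Fin 2, pd i (pd j g) z = fderiv ℝ (fderiv ℝ g) z (coordVec i) (coordVec j) := by
    intro i j
    have h : HasFDerivAt (pd j g) _ z := hd.hasFDerivAt.clm_apply (hasFDerivAt_const (coordVec j) z)
    rw [h.pd_eq]
    simp
  rw [key, key]
  exact (hg.contDiffAt (hM.mem_nhds hz)).isSymmSndFDerivAt (by simpa using two_le_infty) _ _

theorem exists_const_of_pd_eq_zero {M : Set ℂ} (hM : IsOpen M) (hMc : IsPreconnected M) {g : ℂ → ℝ}
    (hg : ∀ z ∈ M, DifferentiableAt ℝ g z) (h0 : ∀ z ∈ M, pd 0 g z = 0)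
    (h1 : ∀ z ∈ M, pd 1 g z = 0) : ∃ c, ∀ z ∈ M, g z = c :=
  hM.exists_is_const_of_fderiv_eq_zero hMc (fun z hz => (hg z hz).differentiableWithinAt)
    fun z hz => fderiv_eq_zero_of_pd (h0 z hz) (h1 z hz)

theorem pd_eq_of_eqOn {M : Set ℂ} (hM : IsOpen M) {g h : ℂ → ℝ} (e : EqOn g h M) (i : Fin 2) {z : ℂ}
    (hz : z ∈ M) : pd i g z = pd i h z :=
  pd_congr (eventually_of_mem (hM.mem_nhds hz) e) i

theorem pd_sub {g h : ℂ → ℝ} {z : ℂ} (hg : DifferentiableAt ℝ g z) (hh : DifferentiableAt ℝ h z)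
    (i : Fin 2) : pd i (fun y => g y - h y) z = pd i g z - pd i h z := by
  rw [(hg.hasFDerivAt.fun_sub hh.hasFDerivAt).pd_eq]
  rfl

theorem pd_quadraticPd (l m n : ℝ) (i j : Fin 2) (z : ℂ) :
    pd i (quadraticPd l m n j) z = if i = j then 2 * l else 0 := by
  rw [(hasFDerivAt_quadraticPd l m n j z).pd_eq]
  fin_cases i <;> fin_cases j <;> simp [coordVec]

/-- A function whose Hessian is a multiple of the identity is a quadratic. -/
theorem exists_quadratic_of_hessian {M : Set ℂ} (hM : IsOpen M) (hMc : IsPreconnected M)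
    {f : ℂ → ℝ} (hf : ContDiffOn ℝ ∞ f M) (h01 : ∀ z ∈ M, pd 0 (pd 1 f) z = 0)
    (heq : ∀ z ∈ M, pd 0 (pd 0 f) z = pd 1 (pd 1 f) z) :
    ∃ l m n p : ℝ, ∀ z ∈ M, f z = quadratic l m n p z := by
  have hs := fun i => contDiffOn_pd hM hf i
  have h10 : ∀ z ∈ M, pd 1 (pd 0 f) z = 0 := fun z hz => by
    rw [pd_pd_comm hM hf hz, h01 z hz]
  have hzero : ∀ (i : Fin 2) (z : ℂ), pd i (fun _ => (0 : ℝ)) z = 0 := fun i z => by simp [pd]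
  -- The common value of `f_xx` and `f_yy` is constant: `∂_x f_xx = ∂_x f_yy = ∂_y f_xy = 0` and
  -- `∂_y f_xx = ∂_x f_xy = 0`.
  obtain ⟨c, hc⟩ := exists_const_of_pd_eq_zero hM hMc
    (fun z hz => differentiableAt_of_contDiffOn hM (contDiffOn_pd hM (hs 0) 0) hz)
    (fun z hz => by
      rw [pd_eq_of_eqOn hM heq 0 hz, pd_pd_comm hM (hs 1) hz, pd_eq_of_eqOn hM h01 1 hz, hzero])
    (fun z hz => by
      rw [pd_pd_comm hM (hs 0) hz, pd_eq_of_eqOn hM h10 0 hz, hzero])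
  have hlin : ∀ i : Fin 2, ∃ r, ∀ z ∈ M, pd i f z - quadraticPd (c / 2) 0 0 i z = r := by
    intro i
    have hd : ∀ z ∈ M, DifferentiableAt ℝ (pd i f) z := fun z hz =>
      differentiableAt_of_contDiffOn hM (hs i) hz
    have hd' : ∀ z, DifferentiableAt ℝ (quadraticPd (c / 2) 0 0 i) z := fun z =>
      (hasFDerivAt_quadraticPd _ _ _ i z).differentiableAt
    have hH : ∀ j : Fin 2, ∀ z ∈ M, pd j (pd i f) z = if j = i then c else 0 := by
      intro j z hz
      fin_cases i <;> fin_cases j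
      · simpa using hc z hz
      · simpa using h10 z hz
      · simpa using h01 z hz
      · simpa [← heq z hz] using hc z hz
    refine exists_const_of_pd_eq_zero hM hMc (fun z hz => (hd z hz).sub (hd' z)) ?_ ?_ <;>
    · intro z hz
      rw [pd_sub (hd z hz) (hd' z), hH _ z hz, pd_quadraticPd]
      split_ifs <;> ring
  obtain ⟨m, hm⟩ := hlin 0
  obtain ⟨n, hn⟩ := hlin 1
  have hdf : ∀ z ∈ M, DifferentiableAt ℝ f z := fun z hz => differentiableAt_of_contDiffOn hM hf hz
  have hdq : ∀ z, DifferentiableAt ℝ (quadratic (c / 2) m n 0) z := fun z =>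
    (hasFDerivAt_quadratic _ _ _ _ z).differentiableAt
  obtain ⟨p, hp⟩ := exists_const_of_pd_eq_zero hM hMc (g := fun z => f z - quadratic (c / 2) m n 0 z)
    (fun z hz => (hdf z hz).sub (hdq z))
    (fun z hz => by
      rw [pd_sub (hdf z hz) (hdq z), pd_quadratic]
      have := hm z hz
      simp only [quadraticPd, Matrix.cons_val_zero] at this ⊢
      linarith)
    (fun z hz => by
      rw [pd_sub (hdf z hz) (hdq z), pd_quadratic]
      have := hn z hz
      simp only [quadraticPd, Matrix.cons_val_one, Matrix.cons_val_zero] at this ⊢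
      linarith)
  refine ⟨c / 2, m, n, p, fun z hz => ?_⟩
  have := hp z hz
  simp only [quadratic] at this ⊢
  linarith

/-! ### Curves and their curvature -/

theorem eq_zero_of_hasDerivAt_of_const {J : Set ℝ} (hJ : IsOpen J) {g : ℝ → ℝ} {g' c t : ℝ}
    (ht : t ∈ J) (hg : HasDerivAt g g' t) (h : ∀ s ∈ J, g s = c) : g' = 0 :=
  hg.unique ((hasDerivAt_const t c).congr_of_eventuallyEq
    (eventually_of_mem (hJ.mem_nhds ht) h))

theorem hasDerivAt_re {g : ℝ → ℂ} {g' : ℂ} {t : ℝ} (h : HasDerivAt g g' t) :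
    HasDerivAt (fun s => (g s).re) g'.re t :=
  Complex.reCLM.hasFDerivAt.comp_hasDerivAt t h

theorem hasDerivAt_im {g : ℝ → ℂ} {g' : ℂ} {t : ℝ} (h : HasDerivAt g g' t) :
    HasDerivAt (fun s => (g s).im) g'.im t :=
  Complex.imCLM.hasFDerivAt.comp_hasDerivAt t h

/-- The curvature of a curve of unit speed on a circle or line is constant. -/
theorem deriv_curvature_eq_zero {J : Set ℝ} (hJ : IsOpen J) {γ T : ℝ → ℂ} {κ : ℝ → ℝ}
    (hγ : ∀ t ∈ J, HasDerivAt γ (T t) t) (hT : ∀ t ∈ J, HasDerivAt T (κ t * Complex.I * T t) t)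
    (hn : ∀ t ∈ J, (T t).re ^ 2 + (T t).im ^ 2 = 1) {C : Set ℂ} (hC : IsCircleOrLine C)
    (hγC : γ '' J ⊆ C) {t k' : ℝ} (ht : t ∈ J) (hκ : HasDerivAt κ k' t) : k' = 0 := by
  have hTre : ∀ t ∈ J, HasDerivAt (fun s => (T s).re) (-(κ t * (T t).im)) t := fun t ht => by
    simpa using hasDerivAt_re (hT t ht)
  have hTim : ∀ t ∈ J, HasDerivAt (fun s => (T s).im) (κ t * (T t).re) t := fun t ht => by
    simpa using hasDerivAt_im (hT t ht)
  have hx : ∀ t ∈ J, HasDerivAt (fun s => (γ s).re) (T t).re t := fun t ht => hasDerivAt_re (hγ t ht)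
  have hy : ∀ t ∈ J, HasDerivAt (fun s => (γ s).im) (T t).im t := fun t ht => hasDerivAt_im (hγ t ht)
  rcases hC with ⟨c, r, hr, rfl⟩ | ⟨p, d, hd, rfl⟩
  -- Differentiate `|γ - c|² = r²` three times: `⟨γ - c, T⟩ = 0`, then `1 + κ ⟨γ - c, iT⟩ = 0`, then
  -- `κ' ⟨γ - c, iT⟩ = 0`. The second equation shows that the last factor is nonzero.
  · have h0 : ∀ s ∈ J, ((γ s).re - c.re) ^ 2 + ((γ s).im - c.im) ^ 2 = r ^ 2 := fun s hs => by
      have h := hγC (mem_image_of_mem γ hs)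
      rw [mem_sphere_iff_norm] at h
      rw [← h, ← Complex.normSq_eq_norm_sq, Complex.normSq_apply]
      simp
      ring
    have h1 : ∀ s ∈ J, ((γ s).re - c.re) * (T s).re + ((γ s).im - c.im) * (T s).im = 0 :=
      fun s hs => by
        have := eq_zero_of_hasDerivAt_of_const hJ hs
          ((((hx s hs).sub_const c.re).pow 2).add (((hy s hs).sub_const c.im).pow 2)) h0
        simp at this
        linarith
    have h2 : ∀ s ∈ J, 1 + κ s * (((γ s).im - c.im) * (T s).re - ((γ s).re - c.re) * (T s).im) = 0 :=
      fun s hs => by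
        have := eq_zero_of_hasDerivAt_of_const hJ hs
          ((((hx s hs).sub_const c.re).mul (hTre s hs)).add
            (((hy s hs).sub_const c.im).mul (hTim s hs))) h1
        linear_combination this - hn s hs
    have h3 := eq_zero_of_hasDerivAt_of_const hJ ht
      ((hκ.mul ((((hy t ht).sub_const c.im).mul (hTre t ht)).sub
            (((hx t ht).sub_const c.re).mul (hTim t ht)))).const_add 1) h2
    have h4 : (((γ t).im - c.im) * (T t).re - ((γ t).re - c.re) * (T t).im) ≠ 0 := fun h => by
      have := h2 t ht
      rw [h] at this
      simp at this
    refine (mul_eq_zero.1 ?_).resolve_right h4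
    simp at h3
    linear_combination h3 + κ t ^ 2 * h1 t ht
  · have h0 : ∀ s ∈ J, ((γ s).re - p.re) * d.im - ((γ s).im - p.im) * d.re = 0 := fun s hs => by
      obtain ⟨u, hu⟩ := hγC (mem_image_of_mem γ hs)
      simp only at hu
      rw [← hu]
      simp
      ring
    have h1 : ∀ s ∈ J, (T s).re * d.im - (T s).im * d.re = 0 := fun s hs =>
      eq_zero_of_hasDerivAt_of_const hJ hs
          ((((hx s hs).sub_const p.re).mul_const d.im).sub
            (((hy s hs).sub_const p.im).mul_const d.re)) h0
    -- `T` is parallel to `d`, so `⟨T, d⟩ ≠ 0`, while differentiating the parallelism gives `κ ⟨T,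
    -- d⟩ = 0`.
    have h2 : ∀ s ∈ J, κ s = 0 := fun s hs => by
      have := eq_zero_of_hasDerivAt_of_const hJ hs
          (((hTre s hs).mul_const d.im).sub ((hTim s hs).mul_const d.re)) h1
      have h3 : (T s).im * d.im + (T s).re * d.re ≠ 0 := fun h => by
        apply hd
        have hn := hn s hs
        have h1 := h1 s hs
        apply Complex.ext
        · simp only [Complex.zero_re]
          linear_combination (-d.re) * hn + (T s).re * h - (T s).im * h1
        · simp only [Complex.zero_im]
          linear_combination (-d.im) * hn + (T s).im * h + (T s).re * h1
      refine (mul_eq_zero.1 ?_).resolve_right h3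
      linear_combination -this
    exact eq_zero_of_hasDerivAt_of_const hJ ht hκ h2

/-- A curve of constant curvature runs along a circle or line. -/
theorem exists_isCircleOrLine_of_curvature_const {J : Set ℝ} (hJ : IsOpen J) (hJc : J.OrdConnected)
    {γ T : ℝ → ℂ} {v κ : ℝ → ℝ} (hγ : ∀ t ∈ J, HasDerivAt γ (v t * T t) t)
    (hT : ∀ t ∈ J, HasDerivAt T (v t * κ t * Complex.I * T t) t) (hn : ∀ t ∈ J, ‖T t‖ = 1)
    (hκ : ∀ t ∈ J, HasDerivAt κ 0 t) : ∃ C, IsCircleOrLine C ∧ γ '' J ⊆ C := by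
  have hconst : ∀ {E : Type} [NormedAddCommGroup E] [NormedSpace ℝ E] {g : ℝ → E},
      (∀ t ∈ J, HasDerivAt g 0 t) → ∃ c, ∀ t ∈ J, g t = c := fun {E} _ _ {g} hg =>
    hJ.exists_is_const_of_deriv_eq_zero hJc.isPreconnected
      (fun t ht => (hg t ht).differentiableAt.differentiableWithinAt) fun t ht => (hg t ht).deriv
  obtain ⟨k, hk⟩ := hconst hκ
  by_cases hk0 : k = 0
  · rcases J.eq_empty_or_nonempty with rfl | ⟨t₀, ht₀⟩
    · exact ⟨Metric.sphere 0 1, Or.inl ⟨0, 1, one_pos, rfl⟩, by simp⟩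
    obtain ⟨d, hd⟩ := hconst (g := T) fun t ht => by
      have := hT t ht
      rw [hk t ht, hk0] at this
      simpa using this
    have hd1 : ‖d‖ = 1 := by rw [← hd t₀ ht₀, hn t₀ ht₀]
    have hdd : d * (starRingEnd ℂ) d = 1 := by
      rw [Complex.mul_conj, Complex.normSq_eq_norm_sq, hd1]
      simp
    -- For `k = 0` the tangent is a constant `d`, and the coordinate of `γ` normal to `d` does not
    -- change.
    obtain ⟨c, hc⟩ := hconst (g := fun t => (γ t * (starRingEnd ℂ) d).im) fun t ht => by
      have := hasDerivAt_im ((hγ t ht).mul_const ((starRingEnd ℂ) d))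
      rwa [hd t ht, mul_assoc, hdd, mul_one, Complex.ofReal_im] at this
    refine ⟨range fun s : ℝ => c * Complex.I * d + s * d,
      Or.inr ⟨_, d, fun h => by simp [h] at hd1, rfl⟩, ?_⟩
    rintro _ ⟨t, ht, rfl⟩
    refine ⟨(γ t * (starRingEnd ℂ) d).re, ?_⟩
    have h := Complex.re_add_im (γ t * (starRingEnd ℂ) d)
    rw [hc t ht] at h
    simp only
    linear_combination d * h + γ t * hdd
  · have hkC : (k : ℂ) ≠ 0 := by exact_mod_cast hk0
    -- The centre of curvature `γ + iT/k` stays fixed, at distance `1/|k|` from the curve.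
    obtain ⟨c, hc⟩ := hconst (g := fun t => γ t + Complex.I / k * T t) fun t ht => by
      have := (hγ t ht).add ((hT t ht).const_mul (Complex.I / (k : ℂ)))
      refine this.congr_deriv ?_
      rw [hk t ht]
      field_simp
      linear_combination (v t : ℂ) * T t * Complex.I_sq
    refine ⟨Metric.sphere c (1 / |k|), Or.inl ⟨c, _, by positivity, rfl⟩, ?_⟩
    rintro _ ⟨t, ht, rfl⟩
    rw [mem_sphere_iff_norm, ← hc t ht]
    simp [hn t ht]

/-! ### The Euler-Lagrange equations of a Randers function -/

theorem hasFDerivAt_norm {w : ℂ} (hw : w ≠ 0) :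
    HasFDerivAt (fun w : ℂ => ‖w‖)
      (‖w‖⁻¹ • (w.re • Complex.reCLM + w.im • Complex.imCLM)) w := by
  have h := ((hasFDerivAt_re w).pow 2).add ((hasFDerivAt_im w).pow 2)
  have hn : ∀ w : ℂ, w.re ^ 2 + w.im ^ 2 = ‖w‖ ^ 2 := fun w => by
    rw [← Complex.normSq_eq_norm_sq, Complex.normSq_apply]
    ring
  have h0 : w.re ^ 2 + w.im ^ 2 ≠ 0 := by
    rw [hn]
    exact pow_ne_zero 2 (norm_ne_zero_iff.2 hw)
  have hs := h.sqrt h0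
  have e : (fun w : ℂ => ‖w‖) = fun w => √(w.re ^ 2 + w.im ^ 2) := by
    ext w
    rw [hn, Real.sqrt_sq (norm_nonneg w)]
  rw [e]
  refine hs.congr_fderiv ?_
  ext u
  simp [hn, Real.sqrt_sq (norm_nonneg w)]
  field_simp

theorem fderiv_randers_velocity (φ a b : ℂ → ℝ) (z : ℂ) {w : ℂ} (hw : w ≠ 0) (e : ℂ) :
    fderiv ℝ (fun w => randers φ a b z w) w e =
      Real.exp (φ z) * (‖w‖⁻¹ * (w.re * e.re + w.im * e.im)) + a z * e.re + b z * e.im := by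
  have h := (((hasFDerivAt_norm hw).const_mul (Real.exp (φ z))).add
    ((hasFDerivAt_re w).const_mul (a z))).add ((hasFDerivAt_im w).const_mul (b z))
  have h' : HasFDerivAt (fun w => randers φ a b z w) _ w := h
  rw [h'.fderiv]
  simp
  ring

theorem fderiv_randers_point {φ a b : ℂ → ℝ} {z : ℂ} (hφ : DifferentiableAt ℝ φ z)
    (ha : DifferentiableAt ℝ a z) (hb : DifferentiableAt ℝ b z) (w e : ℂ) :
    fderiv ℝ (fun z => randers φ a b z w) z e =
      Real.exp (φ z) * fderiv ℝ φ z e * ‖w‖ + fderiv ℝ a z e * w.re + fderiv ℝ b z e * w.im := by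
  have h := ((hφ.hasFDerivAt.exp.mul_const ‖w‖).add (ha.hasFDerivAt.mul_const w.re)).add
    (hb.hasFDerivAt.mul_const w.im)
  have h' : HasFDerivAt (fun z => randers φ a b z w) _ z := h
  rw [h'.fderiv]
  simp
  ring

/-- The Euclidean curvature of the geodesic through `z` with unit tangent vector `T`, in terms of
`f = e^{-φ}` and `q = f² (a_y - b_x)`. -/
def geodesicCurvature (f q : ℂ → ℝ) (z T : ℂ) : ℝ :=
  (q z - (T.re * pd 1 f z - T.im * pd 0 f z)) / f z

/-- Differentiating `f κ = q - ⟨∇f, iT⟩` with `T' = vκ iT`, the rotation of `T` contributes `κ f'`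
on the right, which cancels the `κ f'` on the left. Only the derivative of `q` and `Hess f (T, iT)`
survive. -/
theorem hasDerivAt_geodesicCurvature {f q : ℂ → ℝ} {γ T : ℝ → ℂ} {v t : ℝ}
    (hf : DifferentiableAt ℝ f (γ t)) (hf0 : DifferentiableAt ℝ (pd 0 f) (γ t))
    (hf1 : DifferentiableAt ℝ (pd 1 f) (γ t)) (hq : DifferentiableAt ℝ q (γ t)) (hne : f (γ t) ≠ 0)
    (hγ : HasDerivAt γ (v * T t) t)
    (hT : HasDerivAt T (v * geodesicCurvature f q (γ t) (T t) * Complex.I * T t) t) :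
    HasDerivAt (fun s => geodesicCurvature f q (γ s) (T s))
      (v / f (γ t) * (((T t).re * pd 0 q (γ t) + (T t).im * pd 1 q (γ t))
        - (T t).re * ((T t).re * pd 0 (pd 1 f) (γ t) + (T t).im * pd 1 (pd 1 f) (γ t))
        + (T t).im * ((T t).re * pd 0 (pd 0 f) (γ t) + (T t).im * pd 1 (pd 0 f) (γ t)))) t := by
  have comp : ∀ {g : ℂ → ℝ}, DifferentiableAt ℝ g (γ t) → HasDerivAt (fun s => g (γ s))
      (v * ((T t).re * pd 0 g (γ t) + (T t).im * pd 1 g (γ t))) t := fun {g} hg => by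
    have := hg.hasFDerivAt.comp_hasDerivAt t hγ
    rw [fderiv_apply_eq_pd] at this
    refine this.congr_deriv ?_
    simp
    ring
  have hre := hasDerivAt_re hT
  have him := hasDerivAt_im hT
  simp at hre him
  have h := ((comp hq).sub ((hre.mul (comp hf1)).sub (him.mul (comp hf0)))).div (comp hf) hne
  refine h.congr_deriv ?_
  simp [geodesicCurvature]
  field_simp
  ring

theorem pd_exp_neg {φ : ℂ → ℝ} {z : ℂ} (hφ : DifferentiableAt ℝ φ z) (i : Fin 2) :
    pd i (fun y => Real.exp (-φ y)) z = -(Real.exp (-φ z) * pd i φ z) := by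
  rw [hφ.hasFDerivAt.fun_neg.exp.pd_eq]
  simp [pd]

/-- The form in which the curvature comes out of the Euler–Lagrange equations, before `φ` is
replaced by `f`. -/
theorem geodesicCurvature_eq {φ a b : ℂ → ℝ} {z : ℂ} (hφ : DifferentiableAt ℝ φ z) (T : ℂ) :
    geodesicCurvature (fun y => Real.exp (-φ y))
      (fun y => Real.exp (-φ y) ^ 2 * (pd 1 a y - pd 0 b y)) z T =
      Real.exp (-φ z) * (pd 1 a z - pd 0 b z) + (T.re * pd 1 φ z - T.im * pd 0 φ z) := by
  have := Real.exp_ne_zero (-φ z)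
  rw [geodesicCurvature, pd_exp_neg hφ, pd_exp_neg hφ]
  field_simp
  ring

/-- The unit tangent vector of a geodesic turns at the rate prescribed by `geodesicCurvature`. -/
theorem IsGeodesic.hasDerivAt_tangent {M : Set ℂ} (hM : IsOpen M) {φ a b : ℂ → ℝ}
    (hφ : ContDiffOn ℝ ∞ φ M) (ha : ContDiffOn ℝ ∞ a M) (hb : ContDiffOn ℝ ∞ b M) {J : Set ℝ}
    {γ : ℝ → ℂ} (hγ : IsGeodesic (randers φ a b) M J γ) {t : ℝ} (ht : t ∈ J) :
    HasDerivAt (fun s => (‖deriv γ s‖⁻¹ : ℂ) * deriv γ s)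
      (‖deriv γ t‖ * geodesicCurvature (fun y => Real.exp (-φ y))
        (fun y => Real.exp (-φ y) ^ 2 * (pd 1 a y - pd 0 b y)) (γ t)
          ((‖deriv γ t‖⁻¹ : ℂ) * deriv γ t) * Complex.I * ((‖deriv γ t‖⁻¹ : ℂ) * deriv γ t)) t := by
  have hJ := hγ.isOpen
  have hz := hγ.mem t ht
  have hdφ := differentiableAt_of_contDiffOn hM hφ hz
  have hda := differentiableAt_of_contDiffOn hM ha hz
  have hdb := differentiableAt_of_contDiffOn hM hb hz
  have hw : deriv γ t ≠ 0 := hγ.regular t ht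
  have hwn : ‖deriv γ t‖ ≠ 0 := norm_ne_zero_iff.2 hw
  have hγt : HasDerivAt γ (deriv γ t) t :=
    ((hγ.contDiffOn.contDiffAt (hJ.mem_nhds ht)).differentiableAt (by simp)).hasDerivAt
  have hγ' : DifferentiableAt ℝ (deriv γ) t := by
    have h := ((contDiffOn_succ_iff_deriv_of_isOpen (n := 1) hJ).1 hγ.contDiffOn).2.2
    exact (h.contDiffAt (hJ.mem_nhds ht)).differentiableAt (by simp)
  rw [geodesicCurvature_eq hdφ]
  set T : ℝ → ℂ := fun s => (‖deriv γ s‖⁻¹ : ℂ) * deriv γ s with hTdef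
  have hTd : DifferentiableAt ℝ T t := by
    have hn : DifferentiableAt ℝ (fun s => ‖deriv γ s‖) t := hγ'.norm ℝ hw
    have h1 : DifferentiableAt ℝ (fun s => ((‖deriv γ s‖⁻¹ : ℝ) : ℂ)) t :=
      Complex.ofRealCLM.differentiableAt.comp t (hn.inv hwn)
    simp only [Complex.ofReal_inv] at h1
    exact h1.mul hγ'
  obtain ⟨T', hT⟩ : ∃ T', HasDerivAt T T' t := ⟨_, hTd.hasDerivAt⟩
  have hTre : ∀ s, (T s).re = ‖deriv γ s‖⁻¹ * (deriv γ s).re := fun s => by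
    simp [hTdef, ← Complex.ofReal_inv]
  have hTim : ∀ s, (T s).im = ‖deriv γ s‖⁻¹ * (deriv γ s).im := fun s => by
    simp [hTdef, ← Complex.ofReal_inv]
  have hwre : (deriv γ t).re = ‖deriv γ t‖ * (T t).re := by rw [hTre]; field_simp
  have hwim : (deriv γ t).im = ‖deriv γ t‖ * (T t).im := by rw [hTim]; field_simp
  have hunit : ∀ s ∈ J, (T s).re ^ 2 + (T s).im ^ 2 = 1 := fun s hs => by
    have hns : ‖deriv γ s‖ ≠ 0 := norm_ne_zero_iff.2 (hγ.regular s hs)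
    have := Complex.normSq_eq_norm_sq (deriv γ s)
    rw [Complex.normSq_apply] at this
    rw [hTre, hTim]
    field_simp
    linarith
  have hre := hasDerivAt_re hT
  have him := hasDerivAt_im hT
  have horth : (T t).re * T'.re + (T t).im * T'.im = 0 := by
    have := eq_zero_of_hasDerivAt_of_const hJ ht ((hre.pow 2).add (him.pow 2)) hunit
    simp at this
    linarith
  have comp : ∀ {g : ℂ → ℝ}, DifferentiableAt ℝ g (γ t) → HasDerivAt (fun s => g (γ s))
      (‖deriv γ t‖ * ((T t).re * pd 0 g (γ t) + (T t).im * pd 1 g (γ t))) t := fun {g} hg => by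
    have := hg.hasFDerivAt.comp_hasDerivAt t hγt
    rw [fderiv_apply_eq_pd] at this
    refine this.congr_deriv ?_
    rw [hwre, hwim]
    ring
  -- The momentum `∂F/∂w` is `e^φ T + (a, b)`, so the second derivative of `γ` enters only through
  -- `T'`.
  have hEL : ∀ e : ℂ, Real.exp (φ (γ t)) *
        (‖deriv γ t‖ * ((T t).re * pd 0 φ (γ t) + (T t).im * pd 1 φ (γ t)))
          * ((T t).re * e.re + (T t).im * e.im)
        + Real.exp (φ (γ t)) * (T'.re * e.re + T'.im * e.im)
        + ‖deriv γ t‖ * ((T t).re * pd 0 a (γ t) + (T t).im * pd 1 a (γ t)) * e.re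
        + ‖deriv γ t‖ * ((T t).re * pd 0 b (γ t) + (T t).im * pd 1 b (γ t)) * e.im =
      Real.exp (φ (γ t)) * (e.re * pd 0 φ (γ t) + e.im * pd 1 φ (γ t)) * ‖deriv γ t‖
        + (e.re * pd 0 a (γ t) + e.im * pd 1 a (γ t)) * (‖deriv γ t‖ * (T t).re)
        + (e.re * pd 0 b (γ t) + e.im * pd 1 b (γ t)) * (‖deriv γ t‖ * (T t).im) := by
    intro e
    have h1 := hγ.eulerLagrange t ht e
    rw [fderiv_randers_point hdφ hda hdb, fderiv_apply_eq_pd, fderiv_apply_eq_pd,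
      fderiv_apply_eq_pd, hwre, hwim] at h1
    have h2 : HasDerivAt (fun s => Real.exp (φ (γ s)) * ((T s).re * e.re + (T s).im * e.im)
        + a (γ s) * e.re + b (γ s) * e.im) _ t :=
      (((comp hdφ).exp.mul ((hre.mul_const e.re).fun_add (him.mul_const e.im))).add
        ((comp hda).mul_const e.re)).add ((comp hdb).mul_const e.im)
    have h3 : (fun s => fderiv ℝ (fun w => randers φ a b (γ s) w) (deriv γ s) e) =ᶠ[𝓝 t]
        fun s => Real.exp (φ (γ s)) * ((T s).re * e.re + (T s).im * e.im)
        + a (γ s) * e.re + b (γ s) * e.im := by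
      refine eventually_of_mem (hJ.mem_nhds ht) fun s hs => ?_
      simp only
      rw [fderiv_randers_velocity _ _ _ _ (hγ.regular s hs), hTre, hTim]
      ring
    have := (h2.congr_of_eventuallyEq h3).unique h1
    rw [← this]
  have E0 := hEL 1
  have E1 := hEL Complex.I
  simp at E0 E1
  have hn := hunit t ht
  have hexp : Real.exp (-φ (γ t)) * Real.exp (φ (γ t)) = 1 := by
    rw [← Real.exp_add, neg_add_cancel, Real.exp_zero]
  -- The component of the Euler–Lagrange equations along `iT` determines `⟨T', iT⟩`; together with
  -- `⟨T', T⟩ = 0` this determines `T'`.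
  have key : T'.im * (T t).re - T'.re * (T t).im = ‖deriv γ t‖ *
      (Real.exp (-φ (γ t)) * (pd 1 a (γ t) - pd 0 b (γ t))
        + ((T t).re * pd 1 φ (γ t) - (T t).im * pd 0 φ (γ t))) := by
    have h : Real.exp (φ (γ t)) * (T'.im * (T t).re - T'.re * (T t).im) = ‖deriv γ t‖ *
      ((pd 1 a (γ t) - pd 0 b (γ t))
        + Real.exp (φ (γ t)) * ((T t).re * pd 1 φ (γ t) - (T t).im * pd 0 φ (γ t))) := by
      linear_combination (T t).re * E1 - (T t).im * E0
        + ‖deriv γ t‖ * (pd 1 a (γ t) - pd 0 b (γ t)) * hn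
    linear_combination Real.exp (-φ (γ t)) * h - (T'.im * (T t).re - T'.re * (T t).im) * hexp
      + ‖deriv γ t‖ * ((T t).re * pd 1 φ (γ t) - (T t).im * pd 0 φ (γ t)) * hexp
  refine hT.congr_deriv ?_
  change T' = _ * Complex.I * T t
  change _ = _ * ((_ + ((T t).re * _ - (T t).im * _) : ℝ) : ℂ) * Complex.I * T t
  apply Complex.ext
  · simp only [Complex.mul_re, Complex.mul_im, Complex.ofReal_re, Complex.ofReal_im, Complex.I_re,
      Complex.I_im]
    linear_combination (-(T t).im) * key - T'.re * hn + (T t).re * horth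
  · simp only [Complex.mul_re, Complex.mul_im, Complex.ofReal_re, Complex.ofReal_im, Complex.I_re,
      Complex.I_im]
    linear_combination (T t).re * key - T'.im * hn + (T t).im * horth

/-! ### Existence of geodesics -/

/-- A curve of unit speed that turns at the rate prescribed by `geodesicCurvature` is a geodesic. -/
theorem isGeodesic_of_hasDerivAt {M : Set ℂ} (hM : IsOpen M) {φ a b : ℂ → ℝ}
    (hφ : ContDiffOn ℝ ∞ φ M) (ha : ContDiffOn ℝ ∞ a M) (hb : ContDiffOn ℝ ∞ b M) {J : Set ℝ}
    (hJ : IsOpen J) (hJc : J.OrdConnected) {γ T : ℝ → ℂ} (hmem : ∀ t ∈ J, γ t ∈ M)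
    (hn : ∀ t ∈ J, ‖T t‖ = 1) (hγ : ∀ t ∈ J, HasDerivAt γ (T t) t)
    (hT : ∀ t ∈ J, HasDerivAt T (geodesicCurvature (fun y => Real.exp (-φ y))
        (fun y => Real.exp (-φ y) ^ 2 * (pd 1 a y - pd 0 b y)) (γ t) (T t) * Complex.I * T t) t) :
    IsGeodesic (randers φ a b) M J γ := by
  set f : ℂ → ℝ := fun y => Real.exp (-φ y) with hfdef
  set q : ℂ → ℝ := fun y => f y ^ 2 * (pd 1 a y - pd 0 b y) with hqdef
  have hfc : ContDiffOn ℝ ∞ f M := hφ.neg.exp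
  have hqc : ContDiffOn ℝ ∞ q M := (hfc.pow 2).mul ((contDiffOn_pd hM ha 1).sub
    (contDiffOn_pd hM hb 0))
  have hγc : ContinuousOn γ J := fun t ht => (hγ t ht).continuousAt.continuousWithinAt
  have hTc : ContinuousOn T J := fun t ht => (hT t ht).continuousAt.continuousWithinAt
  have hcomp : ∀ {g : ℂ → ℝ}, ContDiffOn ℝ ∞ g M → ContinuousOn (fun t => g (γ t)) J :=
    fun {g} hg => hg.continuousOn.comp hγc hmem
  have hκc : ContinuousOn (fun t => geodesicCurvature f q (γ t) (T t)) J := by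
    refine ((hcomp hqc).sub (((Complex.continuous_re.comp_continuousOn hTc).mul
      (hcomp (contDiffOn_pd hM hfc 1))).sub ((Complex.continuous_im.comp_continuousOn hTc).mul
      (hcomp (contDiffOn_pd hM hfc 0))))).div (hcomp hfc) fun t _ => Real.exp_ne_zero _
  have hT1 : ContDiffOn ℝ 1 T J := by
    have h : ContDiffOn ℝ (0 + 1) T J := by
      -- Bootstrapping: the equation for `T` has a continuous right-hand side, so `T` is `C¹` and
      -- `γ` is `C²`.
      rw [contDiffOn_succ_iff_deriv_of_isOpen hJ]
      refine ⟨fun t ht => (hT t ht).differentiableAt.differentiableWithinAt, by simp, ?_⟩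
      rw [contDiffOn_zero]
      exact (((Complex.continuous_ofReal.comp_continuousOn hκc).mul
        continuousOn_const).mul hTc).congr fun t ht => (hT t ht).deriv
    simpa using h
  have hd : ∀ t ∈ J, deriv γ t = T t := fun t ht => (hγ t ht).deriv
  refine ⟨hJ, hJc, ?_, hmem, fun t ht h => ?_, fun t ht e => ?_⟩
  · have h : ContDiffOn ℝ (1 + 1) γ J := by
      rw [contDiffOn_succ_iff_deriv_of_isOpen hJ]
      exact ⟨fun t ht => (hγ t ht).differentiableAt.differentiableWithinAt, by simp,
        hT1.congr hd⟩
    rwa [one_add_one_eq_two] at h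
  · have := hn t ht
    rw [← hd t ht, h] at this
    simp at this
  · have hz := hmem t ht
    have hdφ := differentiableAt_of_contDiffOn hM hφ hz
    have hda := differentiableAt_of_contDiffOn hM ha hz
    have hdb := differentiableAt_of_contDiffOn hM hb hz
    have comp : ∀ {g : ℂ → ℝ}, DifferentiableAt ℝ g (γ t) → HasDerivAt (fun s => g (γ s))
        ((T t).re * pd 0 g (γ t) + (T t).im * pd 1 g (γ t)) t := fun {g} hg => by
      have := hg.hasFDerivAt.comp_hasDerivAt t (hγ t ht)
      rwa [fderiv_apply_eq_pd] at this
    have hTt := hT t ht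
    rw [hqdef, hfdef, geodesicCurvature_eq hdφ] at hTt
    have hre := hasDerivAt_re hTt
    have him := hasDerivAt_im hTt
    simp only [Complex.mul_re, Complex.mul_im, Complex.ofReal_re, Complex.ofReal_im, Complex.I_re,
      Complex.I_im] at hre him
    have h2 : HasDerivAt (fun s => Real.exp (φ (γ s)) * ((T s).re * e.re + (T s).im * e.im)
        + a (γ s) * e.re + b (γ s) * e.im) _ t :=
      (((comp hdφ).exp.mul ((hre.mul_const e.re).fun_add (him.mul_const e.im))).add
        ((comp hda).mul_const e.re)).add ((comp hdb).mul_const e.im)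
    have h3 : (fun s => fderiv ℝ (fun w => randers φ a b (γ s) w) (deriv γ s) e) =ᶠ[𝓝 t]
        fun s => Real.exp (φ (γ s)) * ((T s).re * e.re + (T s).im * e.im)
        + a (γ s) * e.re + b (γ s) * e.im := by
      refine eventually_of_mem (hJ.mem_nhds ht) fun s hs => ?_
      have h0 : T s ≠ 0 := fun h => by simpa [h] using hn s hs
      simp only [hd s hs]
      rw [fderiv_randers_velocity _ _ _ _ h0, hn s hs]
      ring
    refine (h2.congr_of_eventuallyEq h3).congr_deriv ?_
    rw [hd t ht, fderiv_randers_point hdφ hda hdb, fderiv_apply_eq_pd, fderiv_apply_eq_pd,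
      fderiv_apply_eq_pd, hn t ht]
    have hexp : Real.exp (-φ (γ t)) * Real.exp (φ (γ t)) = 1 := by
      rw [← Real.exp_add, neg_add_cancel, Real.exp_zero]
    have hunit : (T t).re ^ 2 + (T t).im ^ 2 = 1 := by
      have := Complex.normSq_eq_norm_sq (T t)
      rw [Complex.normSq_apply, hn t ht] at this
      linarith
    linear_combination (pd 1 a (γ t) - pd 0 b (γ t)) * ((T t).re * e.im - (T t).im * e.re) * hexp
      + Real.exp (φ (γ t)) * (e.re * pd 0 φ (γ t) + e.im * pd 1 φ (γ t)) * hunit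

/-- Through every point there is a geodesic in every direction, of unit speed. -/
theorem exists_isGeodesic {M : Set ℂ} (hM : IsOpen M) {φ a b : ℂ → ℝ}
    (hφ : ContDiffOn ℝ ∞ φ M) (ha : ContDiffOn ℝ ∞ a M) (hb : ContDiffOn ℝ ∞ b M) {z : ℂ}
    (hz : z ∈ M) (θ₀ : ℝ) : ∃ (J : Set ℝ) (γ T : ℝ → ℂ), IsGeodesic (randers φ a b) M J γ ∧
      (0 : ℝ) ∈ J ∧ γ 0 = z ∧ T 0 = Complex.exp (θ₀ * Complex.I) ∧ (∀ t, ‖T t‖ = 1) ∧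
      (∀ t ∈ J, HasDerivAt γ (T t) t) ∧
      ∀ t ∈ J, HasDerivAt T (geodesicCurvature (fun y => Real.exp (-φ y))
        (fun y => Real.exp (-φ y) ^ 2 * (pd 1 a y - pd 0 b y)) (γ t) (T t) * Complex.I * T t) t := by
  set f : ℂ → ℝ := fun y => Real.exp (-φ y) with hfdef
  set q : ℂ → ℝ := fun y => f y ^ 2 * (pd 1 a y - pd 0 b y) with hqdef
  have hfc : ContDiffOn ℝ ∞ f M := hφ.neg.exp
  have hqc : ContDiffOn ℝ ∞ q M := (hfc.pow 2).mul ((contDiffOn_pd hM ha 1).sub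
    (contDiffOn_pd hM hb 0))
  -- With the angle of the tangent as unknown, `θ' = κ`, and unit speed is automatic.
  let V : ℂ × ℝ → ℂ × ℝ := fun x => (Complex.exp (x.2 * Complex.I),
    geodesicCurvature f q x.1 (Complex.exp (x.2 * Complex.I)))
  have hV : ContDiffAt ℝ 1 V (z, θ₀) := by
    have hE : ContDiffAt ℝ 1 (fun x : ℂ × ℝ => Complex.exp (x.2 * Complex.I)) (z, θ₀) :=
      ((Complex.ofRealCLM.contDiff.comp contDiff_snd).mul contDiff_const).cexp.contDiffAt
    have hc : ∀ {g : ℂ → ℝ}, ContDiffOn ℝ ∞ g M →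
        ContDiffAt ℝ 1 (fun x : ℂ × ℝ => g x.1) (z, θ₀) := fun {g} hg =>
      ((hg.contDiffAt (hM.mem_nhds hz)).of_le (by simp)).comp (z, θ₀) contDiffAt_fst
    have hr : ContDiffAt ℝ 1 (fun x : ℂ × ℝ => (Complex.exp (x.2 * Complex.I)).re) (z, θ₀) :=
      Complex.reCLM.contDiff.contDiffAt.comp _ hE
    have hi : ContDiffAt ℝ 1 (fun x : ℂ × ℝ => (Complex.exp (x.2 * Complex.I)).im) (z, θ₀) :=
      Complex.imCLM.contDiff.contDiffAt.comp _ hE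
    refine hE.prodMk (((hc hqc).sub ((hr.mul (hc (contDiffOn_pd hM hfc 1))).sub
      (hi.mul (hc (contDiffOn_pd hM hfc 0))))).div (hc hfc) (Real.exp_ne_zero _))
  obtain ⟨α, hα0, ε, hε, hα⟩ :=
    hV.exists_forall_mem_closedBall_exists_eq_forall_mem_Ioo_hasDerivAt₀ 0
  have h0 : (0 : ℝ) ∈ Ioo (0 - ε) (0 + ε) := by simp [hε]
  have hev : ∀ᶠ t in 𝓝 (0 : ℝ), (α t).1 ∈ M := by
    refine ((hα 0 h0).continuousAt.fst).eventually_mem ?_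
    rw [hα0]
    exact hM.mem_nhds hz
  obtain ⟨δ, hδ, hδM⟩ := Metric.eventually_nhds_iff_ball.1 hev
  let J : Set ℝ := Ioo (-min ε δ) (min ε δ)
  have hJε : ∀ t ∈ J, t ∈ Ioo (0 - ε) (0 + ε) := fun t ht => by
    have := min_le_left ε δ
    constructor <;> linarith [ht.1, ht.2]
  have hJM : ∀ t ∈ J, (α t).1 ∈ M := fun t ht => hδM t (by
    have := min_le_right ε δ
    rw [Metric.mem_ball, Real.dist_eq, sub_zero, abs_lt]
    constructor <;> linarith [ht.1, ht.2])
  let T : ℝ → ℂ := fun t => Complex.exp ((α t).2 * Complex.I)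
  have hn : ∀ t, ‖T t‖ = 1 := fun t => Complex.norm_exp_ofReal_mul_I _
  have hγ : ∀ t ∈ J, HasDerivAt (fun t => (α t).1) (T t) t := fun t ht =>
    (ContinuousLinearMap.fst ℝ ℂ ℝ).hasFDerivAt.comp_hasDerivAt t (hα t (hJε t ht))
  have hθ : ∀ t ∈ J, HasDerivAt (fun t => (α t).2) (geodesicCurvature f q (α t).1 (T t)) t :=
    fun t ht => (ContinuousLinearMap.snd ℝ ℂ ℝ).hasFDerivAt.comp_hasDerivAt t (hα t (hJε t ht))
  have hT : ∀ t ∈ J, HasDerivAt T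
      (geodesicCurvature f q (α t).1 (T t) * Complex.I * T t) t := fun t ht => by
    have h := ((hθ t ht).ofReal_comp.mul_const Complex.I).cexp
    refine h.congr_deriv ?_
    ring
  have hm : 0 < min ε δ := lt_min hε hδ
  exact ⟨J, fun t => (α t).1, T,
    isGeodesic_of_hasDerivAt hM hφ ha hb isOpen_Ioo ordConnected_Ioo hJM (fun t _ => hn t) hγ hT,
    ⟨by linarith, hm⟩, by simp [hα0], by simp [T, hα0], hn, hγ, hT⟩

/-! ### All geodesics are circles iff `f` is a quadratic and `q` is constant -/

/-- Vanishing of `κ'` in the direction `θ` is a trigonometric identity: its part of degree one is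
`∂_T q`, and its part of degree two has coefficients `f_xy` and `f_xx - f_yy`. -/
theorem hessian_of_allGeodesicsCircles {M : Set ℂ} (hM : IsOpen M) {φ a b : ℂ → ℝ}
    (hφ : ContDiffOn ℝ ∞ φ M) (ha : ContDiffOn ℝ ∞ a M) (hb : ContDiffOn ℝ ∞ b M)
    (h : AllGeodesicsCircles (randers φ a b) M) {f q : ℂ → ℝ} (hf : f = fun y => Real.exp (-φ y))
    (hq : q = fun y => Real.exp (-φ y) ^ 2 * (pd 1 a y - pd 0 b y)) {z : ℂ} (hz : z ∈ M) :
    pd 0 q z = 0 ∧ pd 1 q z = 0 ∧ pd 0 (pd 1 f) z = 0 ∧ pd 0 (pd 0 f) z = pd 1 (pd 1 f) z := by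
  have hfc : ContDiffOn ℝ ∞ f M := hf ▸ hφ.neg.exp
  have hqc : ContDiffOn ℝ ∞ q M := hq ▸ (hφ.neg.exp.pow 2).mul ((contDiffOn_pd hM ha 1).sub
    (contDiffOn_pd hM hb 0))
  have hd : ∀ {g : ℂ → ℝ}, ContDiffOn ℝ ∞ g M → DifferentiableAt ℝ g z := fun hg =>
    differentiableAt_of_contDiffOn hM hg hz
  have hfz : f z ≠ 0 := by
    rw [hf]
    exact Real.exp_ne_zero _
  have key : ∀ θ : ℝ, (Real.cos θ * pd 0 q z + Real.sin θ * pd 1 q z)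
      - Real.cos θ * (Real.cos θ * pd 0 (pd 1 f) z + Real.sin θ * pd 1 (pd 1 f) z)
      + Real.sin θ * (Real.cos θ * pd 0 (pd 0 f) z + Real.sin θ * pd 1 (pd 0 f) z) = 0 := by
    intro θ
    obtain ⟨J, γ, T, hgeo, h0J, hγ0, hT0, hn, hγ, hT⟩ := exists_isGeodesic hM hφ ha hb hz θ
    rw [← hf, ← hq] at hT
    obtain ⟨C, hC, hγC⟩ := h J γ hgeo
    have hn' : ∀ t ∈ J, (T t).re ^ 2 + (T t).im ^ 2 = 1 := fun t _ => by
      have := Complex.normSq_eq_norm_sq (T t)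
      rw [Complex.normSq_apply, hn t] at this
      linarith
    have hκ := hasDerivAt_geodesicCurvature (f := f) (q := q) (γ := γ) (T := T) (v := 1) (t := 0)
      (hγ0.symm ▸ hd hfc) (hγ0.symm ▸ hd (contDiffOn_pd hM hfc 0))
      (hγ0.symm ▸ hd (contDiffOn_pd hM hfc 1)) (hγ0.symm ▸ hd hqc) (hγ0.symm ▸ hfz)
      (by simpa using hγ 0 h0J) (by simpa using hT 0 h0J)
    have := deriv_curvature_eq_zero hgeo.isOpen hγ hT hn' hC hγC h0J hκ
    rw [hγ0, hT0, Complex.exp_ofReal_mul_I_re, Complex.exp_ofReal_mul_I_im] at this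
    exact (mul_eq_zero.1 this).resolve_left (div_ne_zero one_ne_zero hfz)
  have hsymm := pd_pd_comm hM hfc hz 0 1
  -- Opposite directions separate the odd from the even part; `π/4` then gives `f_xx = f_yy`.
  have k0 := key 0
  have k1 := key Real.pi
  have k2 := key (Real.pi / 2)
  have k3 := key (-(Real.pi / 2))
  have k4 := key (Real.pi / 4)
  rw [Real.cos_pi_div_four, Real.sin_pi_div_four] at k4
  simp at k0 k1 k2 k3
  have e0 : pd 0 q z = 0 := by linarith
  have e1 : pd 1 q z = 0 := by linarith
  have e2 : pd 0 (pd 1 f) z = 0 := by linarith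
  refine ⟨e0, e1, e2, ?_⟩
  rw [e0, e1, ← hsymm, e2] at k4
  have h2 : (√2 / 2 : ℝ) * (√2 / 2) = 1 / 2 := by
    have := Real.mul_self_sqrt (show (0 : ℝ) ≤ 2 by norm_num)
    linarith
  linear_combination 2 * k4 + 2 * (pd 1 (pd 1 f) z - pd 0 (pd 0 f) z) * h2

theorem quadratic_of_allGeodesicsCircles {M : Set ℂ} (hM : IsOpen M) (hMc : IsPreconnected M)
    {φ a b : ℂ → ℝ} (hφ : ContDiffOn ℝ ∞ φ M) (ha : ContDiffOn ℝ ∞ a M) (hb : ContDiffOn ℝ ∞ b M)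
    (h : AllGeodesicsCircles (randers φ a b) M) :
    (∃ l m n p : ℝ, ∀ z ∈ M, Real.exp (-φ z) = quadratic l m n p z) ∧
      ∃ k : ℝ, ∀ z ∈ M, Real.exp (-φ z) ^ 2 * (pd 1 a z - pd 0 b z) = k := by
  have H := fun {z : ℂ} (hz : z ∈ M) => hessian_of_allGeodesicsCircles hM hφ ha hb h rfl rfl hz
  have hqc : ContDiffOn ℝ ∞ (fun y => Real.exp (-φ y) ^ 2 * (pd 1 a y - pd 0 b y)) M :=
    (hφ.neg.exp.pow 2).mul ((contDiffOn_pd hM ha 1).sub (contDiffOn_pd hM hb 0))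
  exact ⟨exists_quadratic_of_hessian hM hMc hφ.neg.exp (fun z hz => (H hz).2.2.1)
      fun z hz => (H hz).2.2.2,
    exists_const_of_pd_eq_zero hM hMc (fun z hz => differentiableAt_of_contDiffOn hM hqc hz)
      (fun z hz => (H hz).1) fun z hz => (H hz).2.1⟩

/-- With `Hess f = 2l · id` the term `Hess f (T, iT)` vanishes, and `q` is constant, so `κ' = 0`
along every geodesic, whatever its parametrization. -/
theorem allGeodesicsCircles_of_quadratic {M : Set ℂ} (hM : IsOpen M)
    {φ a b : ℂ → ℝ} (hφ : ContDiffOn ℝ ∞ φ M) (ha : ContDiffOn ℝ ∞ a M) (hb : ContDiffOn ℝ ∞ b M)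
    {l m n p k : ℝ} (hf : ∀ z ∈ M, Real.exp (-φ z) = quadratic l m n p z)
    (hq : ∀ z ∈ M, Real.exp (-φ z) ^ 2 * (pd 1 a z - pd 0 b z) = k) :
    AllGeodesicsCircles (randers φ a b) M := by
  intro J γ hγ
  set f : ℂ → ℝ := fun y => Real.exp (-φ y) with hfdef
  set q : ℂ → ℝ := fun y => f y ^ 2 * (pd 1 a y - pd 0 b y) with hqdef
  have hfc : ContDiffOn ℝ ∞ f M := hφ.neg.exp
  have hqc : ContDiffOn ℝ ∞ q M := (hfc.pow 2).mul ((contDiffOn_pd hM ha 1).sub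
    (contDiffOn_pd hM hb 0))
  have hH : ∀ i j : Fin 2, ∀ z ∈ M, pd i (pd j f) z = if i = j then 2 * l else 0 := by
    intro i j z hz
    rw [← pd_quadraticPd l m n]
    refine pd_eq_of_eqOn hM (fun y hy => ?_) i hz
    rw [pd_eq_of_eqOn hM hf j hy, pd_quadratic]
  have hq0 : ∀ i : Fin 2, ∀ z ∈ M, pd i q z = 0 := fun i z hz => by
    rw [pd_eq_of_eqOn hM (h := fun _ => k) hq i hz]
    simp [pd]
  have hne : ∀ t ∈ J, (‖deriv γ t‖ : ℂ) ≠ 0 := fun t ht => by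
    exact_mod_cast norm_ne_zero_iff.2 (hγ.regular t ht)
  have hγ' : ∀ t ∈ J, HasDerivAt γ (‖deriv γ t‖ * ((‖deriv γ t‖⁻¹ : ℂ) * deriv γ t)) t :=
    fun t ht => by
      rw [← mul_assoc, mul_inv_cancel₀ (hne t ht), one_mul]
      exact ((hγ.contDiffOn.contDiffAt (hγ.isOpen.mem_nhds ht)).differentiableAt
        (by simp)).hasDerivAt
  have hT := fun t ht => IsGeodesic.hasDerivAt_tangent hM hφ ha hb hγ (t := t) ht
  refine exists_isCircleOrLine_of_curvature_const hγ.isOpen hγ.ordConnected hγ' hT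
    (fun t ht => ?_) fun t ht => ?_
  · have := norm_ne_zero_iff.2 (hγ.regular t ht)
    simp [this]
  · have hz := hγ.mem t ht
    have hd : ∀ {g : ℂ → ℝ}, ContDiffOn ℝ ∞ g M → DifferentiableAt ℝ g (γ t) := fun hg =>
      differentiableAt_of_contDiffOn hM hg hz
    have := hasDerivAt_geodesicCurvature (hd hfc) (hd (contDiffOn_pd hM hfc 0))
      (hd (contDiffOn_pd hM hfc 1)) (hd hqc) (Real.exp_ne_zero _) (hγ' t ht) (hT t ht)
    refine this.congr_deriv ?_
    rw [hq0 0 _ hz, hq0 1 _ hz, hH 0 0 _ hz, hH 0 1 _ hz, hH 1 0 _ hz, hH 1 1 _ hz]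
    simp
    right
    ring

/-! ### The model families -/

/-- The constant term of the quadratic `1 / modelFactor ε`. -/
def modelConst : SignType → ℝ
  | .zero => 1
  | .pos => 1 / 2
  | .neg => 1 / 2

theorem modelConst_pos (ε : SignType) : 0 < modelConst ε := by
  cases ε <;> norm_num [modelConst]

theorem sq_norm_eq (z : ℂ) : ‖z‖ ^ 2 = z.re ^ 2 + z.im ^ 2 := by
  rw [← Complex.normSq_eq_norm_sq, Complex.normSq_apply]
  ring

theorem modelFactor_eq (ε : SignType) (z : ℂ) :
    modelFactor ε z = (quadratic ((ε : ℝ) / 2) 0 0 (modelConst ε) z)⁻¹ := by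
  cases ε <;> simp only [modelFactor, quadratic, modelConst, sq_norm_eq]
  · simp
  · rw [← inv_inj, inv_inv, inv_div]
    simp
    ring
  · rw [← inv_inj, inv_inv, inv_div]
    simp
    ring

theorem quadratic_pos_of_mem_modelDomain {ε : SignType} {z : ℂ} (hz : z ∈ modelDomain ε) :
    0 < quadratic ((ε : ℝ) / 2) 0 0 (modelConst ε) z := by
  cases ε <;> simp only [quadratic, modelConst]
  · simp
  · have : ‖z‖ < 1 := by simpa [modelDomain] using hz
    have h2 : ‖z‖ ^ 2 < 1 := by nlinarith [norm_nonneg z]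
    rw [sq_norm_eq] at h2
    simp
    linarith
  · simp
    nlinarith [sq_nonneg z.re, sq_nonneg z.im]

theorem gaussianCurvature_model (ε : SignType) {z : ℂ} (hz : z ∈ modelDomain ε) :
    gaussianCurvature (conformalMetric (modelFactor ε)) z = (ε : ℝ) := by
  rw [gaussianCurvature_conformalMetric (Eventually.of_forall (modelFactor_eq ε))
    (quadratic_pos_of_mem_modelDomain hz).ne']
  cases ε <;> simp [modelConst] <;> norm_num

/-- The coefficient of `u` in `modelRanders ε τ`. -/
def modelA (ε : SignType) (τ : ℝ) (z : ℂ) : ℝ := modelFactor ε z * (τ * z.im)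

/-- The coefficient of `v` in `modelRanders ε τ`. -/
def modelB (ε : SignType) (τ : ℝ) (z : ℂ) : ℝ := -(modelFactor ε z * (τ * z.re))

theorem contDiffAt_quadratic (l m n p : ℝ) (z : ℂ) : ContDiffAt ℝ ∞ (quadratic l m n p) z := by
  have hr : ContDiff ℝ ∞ Complex.re := Complex.reCLM.contDiff
  have hi : ContDiff ℝ ∞ Complex.im := Complex.imCLM.contDiff
  unfold quadratic
  fun_prop

theorem contDiffAt_modelFactor {ε : SignType} {z : ℂ} (hz : z ∈ modelDomain ε) :
    ContDiffAt ℝ ∞ (modelFactor ε) z := by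
  rw [show modelFactor ε = fun z => (quadratic ((ε : ℝ) / 2) 0 0 (modelConst ε) z)⁻¹ from
    funext (modelFactor_eq ε)]
  exact (contDiffAt_quadratic _ _ _ _ z).inv (quadratic_pos_of_mem_modelDomain hz).ne'

theorem contDiffAt_modelA {ε : SignType} (τ : ℝ) {z : ℂ} (hz : z ∈ modelDomain ε) :
    ContDiffAt ℝ ∞ (modelA ε τ) z :=
  (contDiffAt_modelFactor hz).mul (contDiffAt_const.mul Complex.imCLM.contDiff.contDiffAt)

theorem contDiffAt_modelB {ε : SignType} (τ : ℝ) {z : ℂ} (hz : z ∈ modelDomain ε) :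
    ContDiffAt ℝ ∞ (modelB ε τ) z :=
  ((contDiffAt_modelFactor hz).mul (contDiffAt_const.mul Complex.reCLM.contDiff.contDiffAt)).neg

/-- With `ρ = 1 / (l r² + p)`, the curl is `τ (2ρ + x ρ_x + y ρ_y) = 2τρ² (1/ρ - l r²) = 2pτρ²`.
Thus `q` takes the constant value `2pτ` on a model. -/
theorem curl_model {ε : SignType} (τ : ℝ) {z : ℂ} (hz : z ∈ modelDomain ε) :
    pd 1 (modelA ε τ) z - pd 0 (modelB ε τ) z = 2 * modelConst ε * τ * modelFactor ε z ^ 2 := by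
  have hQ := (quadratic_pos_of_mem_modelDomain hz).ne'
  have h := hasFDerivAt_inv_quadratic hQ
  rw [← show modelFactor ε = fun z => (quadratic ((ε : ℝ) / 2) 0 0 (modelConst ε) z)⁻¹ from
    funext (modelFactor_eq ε)] at h
  have hA : HasFDerivAt (modelA ε τ) _ z := h.mul ((hasFDerivAt_im z).const_mul τ)
  have hB : HasFDerivAt (modelB ε τ) _ z := (h.mul ((hasFDerivAt_re z).const_mul τ)).neg
  rw [hA.pd_eq, hB.pd_eq, modelFactor_eq]
  simp [coordVec, quadraticPd]
  field_simp
  simp only [quadratic]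
  ring

/-! ### Pull-back by a fractional-linear map -/

theorem hasDerivAt_moebius {α β γ δ z : ℂ} (hz : γ * z + δ ≠ 0) :
    HasDerivAt (moebius α β γ δ) ((α * δ - β * γ) / (γ * z + δ) ^ 2) z := by
  have h1 : HasDerivAt (fun z => α * z + β) α z := by
    simpa using ((hasDerivAt_id z).const_mul α).add_const β
  have h2 : HasDerivAt (fun z => γ * z + δ) γ z := by
    simpa using ((hasDerivAt_id z).const_mul γ).add_const δ
  refine (h1.div h2 hz).congr_deriv ?_
  ring

theorem isOpen_moebius_domain (γ δ : ℂ) : IsOpen {z : ℂ | γ * z + δ ≠ 0} :=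
  isOpen_ne_fun (by fun_prop) continuous_const

theorem contDiffAt_moebius {α β γ δ z : ℂ} (hz : γ * z + δ ≠ 0) :
    ContDiffAt ℝ ∞ (moebius α β γ δ) z := by
  have h1 : ContDiffAt ℝ ∞ (fun z => α * z + β) z := by fun_prop
  have h2 : ContDiffAt ℝ ∞ (fun z => γ * z + δ) z := by fun_prop
  exact (h1.mul (h2.inv hz)).congr_of_eventuallyEq
    (Eventually.of_forall fun y => div_eq_mul_inv _ _)

theorem contDiffAt_deriv_moebius {α β γ δ z : ℂ} (hz : γ * z + δ ≠ 0) :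
    ContDiffAt ℝ ∞ (deriv (moebius α β γ δ)) z := by
  have h2 : ContDiffAt ℝ ∞ (fun z => (γ * z + δ) ^ 2) z := by fun_prop
  refine ((contDiffAt_const (c := α * δ - β * γ)).mul
    (h2.inv (pow_ne_zero 2 hz))).congr_of_eventuallyEq
    (eventually_of_mem ((isOpen_moebius_domain γ δ).mem_nhds hz) fun y hy => ?_)
  rw [(hasDerivAt_moebius hy).deriv, div_eq_mul_inv]
  rfl

theorem differentiableAt_deriv_moebius {α β γ δ z : ℂ} (hz : γ * z + δ ≠ 0) :
    DifferentiableAt ℂ (deriv (moebius α β γ δ)) z := by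
  have hd : DifferentiableOn ℂ (moebius α β γ δ) {z : ℂ | γ * z + δ ≠ 0} := fun y hy =>
    (hasDerivAt_moebius hy).differentiableAt.differentiableWithinAt
  exact (hd.deriv (isOpen_moebius_domain γ δ)).differentiableAt
    ((isOpen_moebius_domain γ δ).mem_nhds hz)

/-- The exterior derivative of the pull-back of a `1`-form by a holomorphic map. -/
theorem curl_pullback {T : ℂ → ℂ} {A B : ℂ → ℝ} {z : ℂ} (c : ℝ) (hT : DifferentiableAt ℂ T z)
    (hT' : DifferentiableAt ℂ (deriv T) z) (hA : DifferentiableAt ℝ A (T z))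
    (hB : DifferentiableAt ℝ B (T z)) :
    pd 1 (fun y => c * (A (T y) * (deriv T y).re + B (T y) * (deriv T y).im)) z
      - pd 0 (fun y => c * (B (T y) * (deriv T y).re - A (T y) * (deriv T y).im)) z =
      c * (‖deriv T z‖ ^ 2 * (pd 1 A (T z) - pd 0 B (T z))) := by
  have hTr : HasFDerivAt T _ z := hT.hasDerivAt.hasFDerivAt.restrictScalars ℝ
  -- Since `deriv T` is itself holomorphic, the terms with its derivative cancel by the
  -- Cauchy–Riemann equations.
  have hTr' : HasFDerivAt (deriv T) _ z := hT'.hasDerivAt.hasFDerivAt.restrictScalars ℝ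
  have hAT : HasFDerivAt (fun y => A (T y)) _ z := hA.hasFDerivAt.comp z hTr
  have hBT : HasFDerivAt (fun y => B (T y)) _ z := hB.hasFDerivAt.comp z hTr
  have hre : HasFDerivAt (fun y => (deriv T y).re) _ z := (hasFDerivAt_re _).comp z hTr'
  have him : HasFDerivAt (fun y => (deriv T y).im) _ z := (hasFDerivAt_im _).comp z hTr'
  have h1 := ((hAT.mul hre).add (hBT.mul him)).const_mul c
  have h2 := ((hBT.mul hre).sub (hAT.mul him)).const_mul c
  have e1 := h1.pd_eq 1
  have e2 := h2.pd_eq 0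
  simp only [Pi.add_apply, Pi.mul_apply, Pi.sub_apply] at e1 e2
  rw [e1, e2, sq_norm_eq]
  simp [coordVec, fderiv_apply_eq_pd]
  ring

/-! ### Pull-backs of the model families -/

/-- The coefficient of `u` in the pull-back of `c * modelRanders ε τ` by `T`. -/
def pullA (ε : SignType) (τ c : ℝ) (T : ℂ → ℂ) (z : ℂ) : ℝ :=
  c * (modelA ε τ (T z) * (deriv T z).re + modelB ε τ (T z) * (deriv T z).im)

/-- The coefficient of `v` in the pull-back of `c * modelRanders ε τ` by `T`. -/
def pullB (ε : SignType) (τ c : ℝ) (T : ℂ → ℂ) (z : ℂ) : ℝ :=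
  c * (modelB ε τ (T z) * (deriv T z).re - modelA ε τ (T z) * (deriv T z).im)

/-- The Riemannian part of the pull-back of `c * modelRanders ε τ` by `T`. -/
def pullFactor (ε : SignType) (c : ℝ) (T : ℂ → ℂ) (z : ℂ) : ℝ :=
  c * (modelFactor ε (T z) * ‖deriv T z‖)

theorem modelRanders_pullback (ε : SignType) (τ c : ℝ) (T : ℂ → ℂ) (z w : ℂ) :
    c * modelRanders ε τ (T z) (deriv T z * w) =
      pullFactor ε c T z * ‖w‖ + pullA ε τ c T z * w.re + pullB ε τ c T z * w.im := by
  simp only [modelRanders, pullFactor, pullA, pullB, modelA, modelB, norm_mul, Complex.mul_re,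
    Complex.mul_im]
  ring

section
variable {ε : SignType} {τ c : ℝ} {α β γ δ z : ℂ}

theorem contDiffAt_pullA (h0 : γ * z + δ ≠ 0) (hT : moebius α β γ δ z ∈ modelDomain ε) :
    ContDiffAt ℝ ∞ (pullA ε τ c (moebius α β γ δ)) z := by
  have hre := Complex.reCLM.contDiff.contDiffAt.comp z
    (contDiffAt_deriv_moebius (α := α) (β := β) h0)
  have him := Complex.imCLM.contDiff.contDiffAt.comp z
    (contDiffAt_deriv_moebius (α := α) (β := β) h0)
  exact contDiffAt_const.mul ((((contDiffAt_modelA τ hT).comp z (contDiffAt_moebius h0)).mul hre).add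
    (((contDiffAt_modelB τ hT).comp z (contDiffAt_moebius h0)).mul him))

theorem contDiffAt_pullB (h0 : γ * z + δ ≠ 0) (hT : moebius α β γ δ z ∈ modelDomain ε) :
    ContDiffAt ℝ ∞ (pullB ε τ c (moebius α β γ δ)) z := by
  have hre := Complex.reCLM.contDiff.contDiffAt.comp z
    (contDiffAt_deriv_moebius (α := α) (β := β) h0)
  have him := Complex.imCLM.contDiff.contDiffAt.comp z
    (contDiffAt_deriv_moebius (α := α) (β := β) h0)
  exact contDiffAt_const.mul ((((contDiffAt_modelB τ hT).comp z (contDiffAt_moebius h0)).mul hre).sub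
    (((contDiffAt_modelA τ hT).comp z (contDiffAt_moebius h0)).mul him))

/-- A holomorphic map multiplies both the curl and the squared conformal factor by `|T'|²`, so their
ratio stays constant. The scale `c` enters the curl once and the squared factor twice, whence `1/c`.
-/
theorem curl_pull (hc : 0 < c) (h0 : γ * z + δ ≠ 0) (hT : moebius α β γ δ z ∈ modelDomain ε) :
    pd 1 (pullA ε τ c (moebius α β γ δ)) z - pd 0 (pullB ε τ c (moebius α β γ δ)) z =
      2 * modelConst ε * τ / c * pullFactor ε c (moebius α β γ δ) z ^ 2 := by
  have h := curl_pullback c (hasDerivAt_moebius h0).differentiableAt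
    (differentiableAt_deriv_moebius (α := α) (β := β) h0)
    ((contDiffAt_modelA τ hT).differentiableAt (by simp))
    ((contDiffAt_modelB τ hT).differentiableAt (by simp))
  refine h.trans ?_
  rw [curl_model τ hT, pullFactor]
  field_simp

theorem sq_norm_affine (α β z : ℂ) : ‖α * z + β‖ ^ 2 =
    quadratic (‖α‖ ^ 2) (2 * (α.re * β.re + α.im * β.im)) (2 * (α.re * β.im - α.im * β.re))
      (‖β‖ ^ 2) z := by
  simp only [sq_norm_eq, quadratic, Complex.add_re, Complex.add_im, Complex.mul_re, Complex.mul_im]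
  ring

/-- Since `|T'| = |αδ - βγ| / |γz + δ|²`, clearing denominators makes the reciprocal of the
pulled-back factor a combination of `|αz + β|²` and `|γz + δ|²`, hence a quadratic. -/
theorem pullFactor_mul (hc : 0 < c) (hdet : α * δ - β * γ ≠ 0) (h0 : γ * z + δ ≠ 0)
    (hT : moebius α β γ δ z ∈ modelDomain ε) :
    pullFactor ε c (moebius α β γ δ) z *
      ((ε : ℝ) / 2 * ‖α * z + β‖ ^ 2 + modelConst ε * ‖γ * z + δ‖ ^ 2) =
        c * ‖α * δ - β * γ‖ := by
  have hQ := (quadratic_pos_of_mem_modelDomain hT).ne'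
  have hn : ‖γ * z + δ‖ ≠ 0 := norm_ne_zero_iff.2 h0
  have e : (ε : ℝ) / 2 * ‖α * z + β‖ ^ 2 + modelConst ε * ‖γ * z + δ‖ ^ 2 =
      quadratic ((ε : ℝ) / 2) 0 0 (modelConst ε) (moebius α β γ δ z) * ‖γ * z + δ‖ ^ 2 := by
    simp only [quadratic, ← sq_norm_eq, moebius, norm_div]
    generalize ‖γ * z + δ‖ = N at hn
    field_simp
    ring
  rw [e, pullFactor, modelFactor_eq, (hasDerivAt_moebius h0).deriv, norm_div, norm_pow]
  field_simp

/-- A Randers function which is equivalent to a model has quadratic `f` and constant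
`f² (a_y - b_x)`. -/
theorem quadratic_of_equivModel {M : Set ℂ} (hM : IsOpen M) {φ a b : ℂ → ℝ}
    (h : EquivModel (randers φ a b) M ε τ) :
    (∃ l m n p : ℝ, ∀ z ∈ M, Real.exp (-φ z) = quadratic l m n p z) ∧
      ∃ k : ℝ, ∀ z ∈ M, Real.exp (-φ z) ^ 2 * (pd 1 a z - pd 0 b z) = k := by
  obtain ⟨α, β, γ, δ, c, hdet, hc, hdom, hU⟩ := h
  set T := moebius α β γ δ with hTdef
  have hloc : ∀ z ∈ M, Real.exp (φ z) = pullFactor ε c T z ∧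
      pd 1 a z - pd 0 b z = pd 1 (pullA ε τ c T) z - pd 0 (pullB ε τ c T) z := by
    intro z hz
    obtain ⟨r, hr, hrM⟩ := Metric.isOpen_iff.1 hM z hz
    -- Both claims are pointwise, so a ball, where a potential `ψ` is available, suffices.
    have hsc : IsSimplyConnected (Metric.ball z r) := by
      have : ContractibleSpace (Metric.ball z r) :=
        (convex_ball z r).contractibleSpace ⟨z, Metric.mem_ball_self hr⟩
      exact (inferInstance : SimplyConnectedSpace (Metric.ball z r))
    obtain ⟨ψ, hψ, hF⟩ := hU _ hrM Metric.isOpen_ball hsc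
    have hcoef : ∀ y ∈ Metric.ball z r, Real.exp (φ y) = pullFactor ε c T y ∧
        a y = pullA ε τ c T y + pd 0 ψ y ∧ b y = pullB ε τ c T y + pd 1 ψ y := by
      intro y hy
      -- The vectors `1` and `-1` separate the norm part from the linear part.
      have h1 := hF y hy 1
      have h2 := hF y hy (-1)
      have h3 := hF y hy Complex.I
      rw [modelRanders_pullback, fderiv_apply_eq_pd, randers] at h1 h2 h3
      simp at h1 h2 h3
      have e : Real.exp (φ y) = pullFactor ε c T y := by linarith
      exact ⟨e, by linarith, by linarith⟩
    have hzr := Metric.mem_ball_self (x := z) hr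
    refine ⟨(hcoef z hzr).1, ?_⟩
    have hA : HasFDerivAt (pullA ε τ c T) _ z :=
      ((contDiffAt_pullA (hdom z hz).1 (hdom z hz).2).differentiableAt (by simp)).hasFDerivAt
    have hB : HasFDerivAt (pullB ε τ c T) _ z :=
      ((contDiffAt_pullB (hdom z hz).1 (hdom z hz).2).differentiableAt (by simp)).hasFDerivAt
    have hψi : ∀ i : Fin 2, HasFDerivAt (pd i ψ) _ z := fun i =>
      (differentiableAt_of_contDiffOn Metric.isOpen_ball
        (contDiffOn_pd Metric.isOpen_ball hψ i) hzr).hasFDerivAt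
    rw [pd_eq_of_eqOn Metric.isOpen_ball (fun y hy => (hcoef y hy).2.1) 1 hzr,
      pd_eq_of_eqOn Metric.isOpen_ball (fun y hy => (hcoef y hy).2.2) 0 hzr,
      (hA.fun_add (hψi 0)).pd_eq, (hB.fun_add (hψi 1)).pd_eq]
    have := pd_pd_comm Metric.isOpen_ball hψ hzr 0 1
    simp only [add_apply, pd] at this ⊢
    linarith
  have hfac : ∀ z ∈ M, Real.exp (-φ z) = (pullFactor ε c T z)⁻¹ := fun z hz => by
    rw [Real.exp_neg, (hloc z hz).1]
  refine ⟨⟨((ε : ℝ) / 2 * ‖α‖ ^ 2 + modelConst ε * ‖γ‖ ^ 2) / (c * ‖α * δ - β * γ‖),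
    ((ε : ℝ) / 2 * (2 * (α.re * β.re + α.im * β.im))
      + modelConst ε * (2 * (γ.re * δ.re + γ.im * δ.im))) / (c * ‖α * δ - β * γ‖),
    ((ε : ℝ) / 2 * (2 * (α.re * β.im - α.im * β.re))
      + modelConst ε * (2 * (γ.re * δ.im - γ.im * δ.re))) / (c * ‖α * δ - β * γ‖),
    ((ε : ℝ) / 2 * ‖β‖ ^ 2 + modelConst ε * ‖δ‖ ^ 2) / (c * ‖α * δ - β * γ‖), fun z hz => ?_⟩,
    2 * modelConst ε * τ / c, fun z hz => ?_⟩
  · have h1 := pullFactor_mul hc hdet (hdom z hz).1 (hdom z hz).2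
    have h2 : pullFactor ε c T z ≠ 0 := by
      rw [← (hloc z hz).1]
      exact Real.exp_ne_zero _
    have h3 : c * ‖α * δ - β * γ‖ ≠ 0 := mul_ne_zero hc.ne' (norm_ne_zero_iff.2 hdet)
    rw [sq_norm_affine, sq_norm_affine] at h1
    have hQ : ∀ l m n p l' m' n' p' r s d : ℝ, quadratic ((r * l + s * l') / d)
        ((r * m + s * m') / d) ((r * n + s * n') / d) ((r * p + s * p') / d) z =
        (r * quadratic l m n p z + s * quadratic l' m' n' p' z) / d := by
      intros
      simp only [quadratic]
      ring
    rw [hfac z hz, hQ, eq_div_iff h3, ← h1, inv_mul_cancel_left₀ h2]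
  · have h2 : pullFactor ε c T z ≠ 0 := by
      rw [← (hloc z hz).1]
      exact Real.exp_ne_zero _
    rw [hTdef] at h2
    rw [hfac z hz, (hloc z hz).2, hTdef, curl_pull hc (hdom z hz).1 (hdom z hz).2]
    field_simp

/-- A Randers function with the Riemannian part and the exterior derivative of the pull-back of a
model is equivalent to that model. -/
theorem equivModel_of_curl_eq {M : Set ℂ} (hM : IsOpen M) {φ a b : ℂ → ℝ}
    (ha : ContDiffOn ℝ ∞ a M) (hb : ContDiffOn ℝ ∞ b M) (hdet : α * δ - β * γ ≠ 0) (hc : 0 < c)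
    (hdom : ∀ z ∈ M, γ * z + δ ≠ 0 ∧ moebius α β γ δ z ∈ modelDomain ε)
    (hfac : ∀ z ∈ M, Real.exp (φ z) = pullFactor ε c (moebius α β γ δ) z)
    (hcurl : ∀ z ∈ M, pd 1 a z - pd 0 b z =
      pd 1 (pullA ε τ c (moebius α β γ δ)) z - pd 0 (pullB ε τ c (moebius α β γ δ)) z) :
    EquivModel (randers φ a b) M ε τ := by
  refine ⟨α, β, γ, δ, c, hdet, hc, hdom, fun U hUM hUo hU => ?_⟩
  set T := moebius α β γ δ with hTdef
  have hA : ContDiffOn ℝ ∞ (pullA ε τ c T) M := fun z hz =>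
    (contDiffAt_pullA (hdom z hz).1 (hdom z hz).2).contDiffWithinAt
  have hB : ContDiffOn ℝ ∞ (pullB ε τ c T) M := fun z hz =>
    (contDiffAt_pullB (hdom z hz).1 (hdom z hz).2).contDiffWithinAt
  -- The difference of the two linear parts; equality of curls says that it is closed.
  let η : ℂ → ℂ →L[ℝ] ℝ := fun z =>
    (a z - pullA ε τ c T z) • Complex.reCLM + (b z - pullB ε τ c T z) • Complex.imCLM
  have hη : ContDiffOn ℝ ∞ η M :=
    ((ha.sub hA).smul contDiffOn_const).add ((hb.sub hB).smul contDiffOn_const)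
  have hsymm : ∀ z ∈ U, ∀ x y, fderiv ℝ η z x y = fderiv ℝ η z y x := by
    intro z hzU x y
    have hz := hUM hzU
    have hd : ∀ {g : ℂ → ℝ}, ContDiffOn ℝ ∞ g M → DifferentiableAt ℝ g z := fun hg =>
      differentiableAt_of_contDiffOn hM hg hz
    have h : HasFDerivAt η _ z :=
      (((hd ha).hasFDerivAt.fun_sub (hd hA).hasFDerivAt).smul_const Complex.reCLM).add
        (((hd hb).hasFDerivAt.fun_sub (hd hB).hasFDerivAt).smul_const Complex.imCLM)
    have hc := hcurl z hz
    rw [h.fderiv]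
    simp [fderiv_apply_eq_pd]
    linear_combination (x.im * y.re - x.re * y.im) * hc
  obtain ⟨ψ, hψ⟩ := exists_hasFDerivAt_of_isSimplyConnected hUo hU
    ((hη.mono hUM).differentiableOn (by simp)) hsymm
  refine ⟨ψ, ?_, fun z hz w => ?_⟩
  · rw [contDiffOn_infty_iff_fderiv_of_isOpen hUo]
    exact ⟨fun z hz => (hψ z hz).differentiableAt.differentiableWithinAt,
      (hη.mono hUM).congr fun z hz => (hψ z hz).fderiv⟩
  · rw [modelRanders_pullback, (hψ z hz).fderiv, randers, hfac z (hUM hz)]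
    simp [η]
    ring

end

/-! ### Normal forms of quadratics -/

/-- Completing the square: `2lz + (m + in)` is the gradient of the quadratic `f`, so this is `|∇f|²
= 4lf - D`. -/
theorem sq_norm_two_mul_add (l m n p : ℝ) (z : ℂ) :
    ‖((2 * l : ℝ) : ℂ) * z + ⟨m, n⟩‖ ^ 2 =
      4 * l * quadratic l m n p z - (4 * l * p - (m ^ 2 + n ^ 2)) := by
  simp [sq_norm_eq, quadratic]
  ring

/-- The sign of `D` gives `ε`. When `l ≠ 0`, the completed square writes `4lf` as `|2lz + (m + in)|²
+ D`, whose two terms, up to constants, become `|αz + β|²` and `|γz + δ|²`; only the square is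
needed when `D = 0`. -/
theorem exists_moebius_of_quadratic {l m n p : ℝ} (h : ∃ z, 0 < quadratic l m n p z) :
    ∃ (ε : SignType) (α β γ δ : ℂ) (c : ℝ), α * δ - β * γ ≠ 0 ∧ 0 < c ∧
      (∀ z, 0 < quadratic l m n p z → γ * z + δ ≠ 0) ∧
      ∀ z, (ε : ℝ) / 2 * ‖α * z + β‖ ^ 2 + modelConst ε * ‖γ * z + δ‖ ^ 2 =
        c * ‖α * δ - β * γ‖ * quadratic l m n p z := by
  obtain ⟨z₀, hz₀⟩ := h
  have hsq := sq_norm_two_mul_add l m n p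
  set D := 4 * l * p - (m ^ 2 + n ^ 2) with hD
  rcases lt_trichotomy D 0 with hD0 | hD0 | hD0
  · have hs : 0 < √(-D) := Real.sqrt_pos.2 (by linarith)
    have hss : √(-D) ^ 2 = -D := Real.sq_sqrt (by linarith)
    have hsC : (√(-D) : ℂ) ≠ 0 := by exact_mod_cast hs.ne'
    have hsn : ‖(√(-D) : ℂ)‖ = √(-D) := by simp
    rcases lt_trichotomy l 0 with hl | hl | hl
    -- Here `f > 0` is the disk `|2lz + (m + in)| < √(-D)`, rescaled to the unit disk.
    · refine ⟨.neg, ((2 * l : ℝ) : ℂ), ⟨m, n⟩, 0, √(-D), 1 / √(-D), ?_, by positivity,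
        fun z _ => by simpa using hsC, fun z => ?_⟩
      · simpa using ⟨hl.ne, hs.ne'⟩
      · rw [hsq, zero_mul, zero_add, mul_zero, sub_zero, norm_mul, hsn, hss, Complex.norm_real,
          Real.norm_eq_abs, abs_of_neg (by linarith)]
        simp [modelConst]
        field_simp
        ring
    -- Here `f > 0` is a half-plane: `f = Re ζ` for `ζ = μz + p`, and the map is the Cayley
    -- transform `(ζ - 1) / (ζ + 1)`.
    · set μ : ℂ := ⟨m, -n⟩ with hμ
      have hμ0 : μ ≠ 0 := fun h => by
        have h1 := congrArg Complex.re h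
        have h2 := congrArg Complex.im h
        simp [hμ] at h1 h2
        rw [hD, hl, h1, h2] at hD0
        simp at hD0
      have hdet : μ * ((p + 1 : ℝ) : ℂ) - ((p - 1 : ℝ) : ℂ) * μ = 2 * μ := by
        push_cast
        ring
      refine ⟨.neg, μ, ((p - 1 : ℝ) : ℂ), μ, ((p + 1 : ℝ) : ℂ), 1 / ‖μ‖, ?_,
        one_div_pos.2 (norm_pos_iff.2 hμ0), fun z hz h => ?_, fun z => ?_⟩
      · rw [hdet]
        exact mul_ne_zero two_ne_zero hμ0
      · have h1 := congrArg Complex.re h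
        simp [hμ] at h1
        simp [quadratic, hl] at hz
        linarith
      · have hn : ‖μ‖ ≠ 0 := norm_ne_zero_iff.2 hμ0
        rw [hdet, norm_mul, sq_norm_eq, sq_norm_eq]
        generalize ‖μ‖ = N at hn
        simp [modelConst, quadratic, hl, hμ]
        field_simp
        ring
    -- Here `f > 0` is the exterior of a closed disk, brought into the unit disk by an inversion.
    · refine ⟨.neg, 0, √(-D), ((2 * l : ℝ) : ℂ), ⟨m, n⟩, 1 / √(-D), ?_, by positivity,
        fun z hz h => ?_, fun z => ?_⟩
      · simpa using ⟨hs.ne', hl.ne'⟩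
      · have := hsq z
        rw [h] at this
        simp at this
        nlinarith [mul_pos hl hz]
      · rw [hsq, zero_mul, zero_add, zero_mul, zero_sub, norm_neg, norm_mul, hsn, hss,
          Complex.norm_real, Real.norm_eq_abs, abs_of_pos (by linarith)]
        simp [modelConst]
        field_simp
        ring
  · by_cases hl : l = 0
    · have h0 : m ^ 2 + n ^ 2 = 0 := by
        rw [hl] at hD
        linarith
      have hm : m = 0 := by nlinarith [sq_nonneg m, sq_nonneg n]
      have hn : n = 0 := by nlinarith [sq_nonneg m, sq_nonneg n]
      have hp : 0 < p := by simpa [quadratic, hl, hm, hn] using hz₀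
      refine ⟨.zero, 1, 0, 0, 1, 1 / p, by simp, by positivity, fun z _ => by simp, fun z => ?_⟩
      simp [quadratic, hl, hm, hn, modelConst, hp.ne']
    -- For `D = 0` one has `4lf = |2lz + (m + in)|²`: the flat metric seen through an inversion.
    · have hl0 : 0 < l := by
        have := hsq z₀
        by_contra hneg
        have hlt : l < 0 := lt_of_le_of_ne (not_lt.1 hneg) hl
        nlinarith [mul_pos_of_neg_of_neg hlt (neg_lt_zero.2 hz₀),
          sq_nonneg ‖((2 * l : ℝ) : ℂ) * z₀ + ⟨m, n⟩‖]
      refine ⟨.zero, 0, 1, ((2 * l : ℝ) : ℂ), ⟨m, n⟩, 2, by simpa using hl, by norm_num,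
        fun z hz h => ?_, fun z => ?_⟩
      · have := hsq z
        rw [h] at this
        simp at this
        nlinarith [mul_pos hl0 hz]
      · have hn : ‖(0 : ℂ) * ⟨m, n⟩ - 1 * ((2 * l : ℝ) : ℂ)‖ = 2 * l := by
          rw [zero_mul, one_mul, zero_sub, norm_neg, Complex.norm_real, Real.norm_eq_abs,
            abs_of_pos (by linarith)]
        rw [hsq, hn, hD0]
        simp [modelConst]
        left
        ring
  · have hs : 0 < √D := Real.sqrt_pos.2 hD0
    have hss : √D ^ 2 = D := Real.sq_sqrt hD0.le
    have hsC : (√D : ℂ) ≠ 0 := by exact_mod_cast hs.ne'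
    have hsn : ‖(√D : ℂ)‖ = √D := by simp
    have hl : 0 < l := by
      have := hsq z₀
      by_contra hneg
      nlinarith [mul_nonneg_of_nonpos_of_nonpos (not_lt.1 hneg) (neg_nonpos.2 hz₀.le),
        sq_nonneg ‖((2 * l : ℝ) : ℂ) * z₀ + ⟨m, n⟩‖]
    refine ⟨.pos, ((2 * l : ℝ) : ℂ), ⟨m, n⟩, 0, √D, 1 / √D, ?_, by positivity,
      fun z _ => by simpa using hsC, fun z => ?_⟩
    · simpa using ⟨hl.ne', hs.ne'⟩
    · rw [hsq, zero_mul, zero_add, mul_zero, sub_zero, norm_mul, hsn, hss, Complex.norm_real,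
        Real.norm_eq_abs, abs_of_pos (by linarith)]
      simp [modelConst]
      field_simp
      ring

theorem moebius_mem_modelDomain {ε : SignType} {α β γ δ z : ℂ} (h0 : γ * z + δ ≠ 0)
    (h : 0 < (ε : ℝ) / 2 * ‖α * z + β‖ ^ 2 + modelConst ε * ‖γ * z + δ‖ ^ 2) :
    moebius α β γ δ z ∈ modelDomain ε := by
  cases ε
  · trivial
  · have hn : 0 < ‖γ * z + δ‖ := norm_pos_iff.2 h0
    simp [modelConst] at h
    simp only [modelDomain, mem_ball_zero_iff, moebius, norm_div]
    rw [div_lt_one hn]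
    exact lt_of_pow_lt_pow_left₀ 2 hn.le (by linarith)
  · trivial

theorem equivModel_of_quadratic {M : Set ℂ} (hM : IsOpen M) {φ a b : ℂ → ℝ}
    (ha : ContDiffOn ℝ ∞ a M) (hb : ContDiffOn ℝ ∞ b M) {l m n p k : ℝ}
    (hf : ∀ z ∈ M, Real.exp (-φ z) = quadratic l m n p z)
    (hq : ∀ z ∈ M, Real.exp (-φ z) ^ 2 * (pd 1 a z - pd 0 b z) = k) :
    ∃ (ε : SignType) (τ : ℝ), EquivModel (randers φ a b) M ε τ := by
  rcases M.eq_empty_or_nonempty with rfl | ⟨z₀, hz₀⟩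
  -- On empty `M` any data work, because simply connected sets are nonempty.
  · refine ⟨0, 0, 1, 0, 0, 1, 1, by simp, one_pos, by simp, fun U hU _ hUs => ?_⟩
    exact absurd (hU hUs.nonempty.some_mem) (notMem_empty _)
  have hpos : ∀ z ∈ M, 0 < quadratic l m n p z := fun z hz => by
    rw [← hf z hz]
    exact Real.exp_pos _
  obtain ⟨ε, α, β, γ, δ, c, hdet, hc, hne, hQ⟩ := exists_moebius_of_quadratic ⟨z₀, hpos z₀ hz₀⟩
  have hdetn : 0 < ‖α * δ - β * γ‖ := norm_pos_iff.2 hdet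
  have hdom : ∀ z ∈ M, γ * z + δ ≠ 0 ∧ moebius α β γ δ z ∈ modelDomain ε := fun z hz => by
    refine ⟨hne z (hpos z hz), moebius_mem_modelDomain (hne z (hpos z hz)) ?_⟩
    rw [hQ]
    exact mul_pos (mul_pos hc hdetn) (hpos z hz)
  have hfac : ∀ z ∈ M, Real.exp (φ z) = pullFactor ε c (moebius α β γ δ) z := fun z hz => by
    have h1 := pullFactor_mul hc hdet (hdom z hz).1 (hdom z hz).2
    rw [hQ, ← hf z hz] at h1
    have h2 : pullFactor ε c (moebius α β γ δ) z * Real.exp (-φ z) = 1 := by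
      refine mul_left_cancel₀ (mul_pos hc hdetn).ne' ?_
      linear_combination h1
    rw [Real.exp_neg, mul_inv_eq_one₀ (Real.exp_ne_zero _)] at h2
    exact h2.symm
  -- The value of `τ` solves `2 * modelConst ε * τ / c = k`, the constant found in `curl_pull`.
  refine ⟨ε, k * c / (2 * modelConst ε), equivModel_of_curl_eq hM ha hb hdet hc hdom hfac
    fun z hz => ?_⟩
  have hε := (modelConst_pos ε).ne'
  rw [curl_pull hc (hdom z hz).1 (hdom z hz).2, ← hfac z hz, ← hq z hz, Real.exp_neg]
  have := Real.exp_ne_zero (φ z)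
  field_simp

end CircleGeodesics

end

/-! ### The main theorem: assembling the equivalences. -/

theorem mainTheorem1 (M : Set ℂ) (hM : IsOpen M) (hMc : IsPreconnected M)
    (φ a b : ℂ → ℝ) (hφ : ContDiffOn ℝ ∞ φ M) (ha : ContDiffOn ℝ ∞ a M) (hb : ContDiffOn ℝ ∞ b M)
    (hpos : ∀ z ∈ M, ∀ w : ℂ, w ≠ 0 → 0 < CircleGeodesics.randers φ a b z w) :
    -- if all geodesics are circles, then the Riemannian part has constant curvature
    (CircleGeodesics.AllGeodesicsCircles (CircleGeodesics.randers φ a b) M →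
      ∃ K : ℝ, ∀ z ∈ M, CircleGeodesics.gaussianCurvature
        (CircleGeodesics.conformalMetric fun p => Real.exp (φ p)) z = K) ∧
    -- all geodesics are circles iff `f` is a quadratic and `f² (a_y - b_x)` is constant
    (CircleGeodesics.AllGeodesicsCircles (CircleGeodesics.randers φ a b) M ↔
      (∃ l m n p : ℝ, ∀ z ∈ M,
        Real.exp (-φ z) = l * (z.re ^ 2 + z.im ^ 2) + m * z.re + n * z.im + p) ∧
      (∃ k : ℝ, ∀ z ∈ M,
        Real.exp (-φ z) ^ 2 * (CircleGeodesics.pd 1 a z - CircleGeodesics.pd 0 b z) = k)) ∧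
    -- the value of the curvature for a quadratic `f`
    (∀ l m n p : ℝ,
      (∀ z ∈ M, Real.exp (-φ z) = l * (z.re ^ 2 + z.im ^ 2) + m * z.re + n * z.im + p) →
      ∀ z ∈ M, CircleGeodesics.gaussianCurvature
        (CircleGeodesics.conformalMetric fun p => Real.exp (φ p)) z
          = 4 * l * p - (m ^ 2 + n ^ 2)) ∧
    -- all geodesics are circles iff `F` is equivalent to a member of one of the three families
    (CircleGeodesics.AllGeodesicsCircles (CircleGeodesics.randers φ a b) M ↔
      ∃ (ε : SignType) (τ : ℝ),
        CircleGeodesics.EquivModel (CircleGeodesics.randers φ a b) M ε τ) ∧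
    -- the Riemannian parts of the three families have curvature `0`, `1`, `-1`
    (∀ ε : SignType, ∀ z ∈ CircleGeodesics.modelDomain ε,
      CircleGeodesics.gaussianCurvature
        (CircleGeodesics.conformalMetric (CircleGeodesics.modelFactor ε)) z = (ε : ℝ)) := by
  have hcurv : ∀ l m n p : ℝ,
      (∀ z ∈ M, Real.exp (-φ z) = l * (z.re ^ 2 + z.im ^ 2) + m * z.re + n * z.im + p) →
      ∀ z ∈ M, CircleGeodesics.gaussianCurvature
        (CircleGeodesics.conformalMetric fun p => Real.exp (φ p)) z
          = 4 * l * p - (m ^ 2 + n ^ 2) := fun l m n p h z hz => by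
    refine CircleGeodesics.gaussianCurvature_conformalMetric
      (Filter.eventually_of_mem (hM.mem_nhds hz) fun y hy => ?_) ?_
    · rw [CircleGeodesics.quadratic, ← h y hy, Real.exp_neg, inv_inv]
    · rw [CircleGeodesics.quadratic, ← h z hz]
      exact Real.exp_ne_zero _
  have hquad := CircleGeodesics.quadratic_of_allGeodesicsCircles hM hMc hφ ha hb
  refine ⟨fun h => ?_, ⟨hquad, ?_⟩, hcurv, ⟨fun h => ?_, ?_⟩,
    fun ε z hz => CircleGeodesics.gaussianCurvature_model ε hz⟩
  · obtain ⟨⟨l, m, n, p, hf⟩, -⟩ := hquad h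
    exact ⟨_, hcurv l m n p hf⟩
  · rintro ⟨⟨l, m, n, p, hf⟩, k, hk⟩
    exact CircleGeodesics.allGeodesicsCircles_of_quadratic hM hφ ha hb hf hk
  · obtain ⟨⟨l, m, n, p, hf⟩, k, hk⟩ := hquad h
    exact CircleGeodesics.equivModel_of_quadratic hM ha hb hf hk
  · rintro ⟨ε, τ, h⟩
    obtain ⟨⟨l, m, n, p, hf⟩, k, hk⟩ := CircleGeodesics.quadratic_of_equivModel hM h
    exact CircleGeodesics.allGeodesicsCircles_of_quadratic hM hφ ha hb hf hk
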